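/- Let $\ell^2=\ell^2(\mathbb{N};\mathbb{C})$ with $\mathbb{N}=\{0,1,2,\dots\}$, let $h^1=\{a\in\ell^2:\sum_{n\ge 0}(n+1)^2|a_n|^2<\infty\}$, let $M=\mathrm{diag}(1,2,3,\dots):h^1\to\ell^2$, and let $S_{njkl}=\min(n,j,k,l)+1$. For $p\in[0,1)$ let $A_n(p)=(1-p^2)p^n$, $n\in\mathbb{N}$ (with $0^0=1$), be the normalized ground state of the conformal flow, a standing wave of frequency $\lambda=1$, and let $L_\pm=L_\pm(p):h^1\subset\ell^2\to\ell^2$ be the linearized (Hessian) operators at $A=A(p)$, $$(L_\pm a)_n=\sum_{j=0}^\infty\sum_{k=0}^{n+j}S_{njk,n+j-k}\left[2A_jA_{n+j-k}a_k\pm A_kA_{n+j-k}a_j\right]-(n+1)a_n,\qquad n\in\mathbb{N}.$$ Consider the spectral problem $$L_-a=\Lambda Mb,\qquad L_+b=-\Lambda Ma,\qquad (a,b)\in h^1\times h^1,\ (a,b)\neq(0,0),\ \Lambda\in\mathbb{C},$$ that is, the eigenvalue problem for the operator $(a,b)\mapsto(-M^{-1}L_+b,\;M^{-1}L_-a)$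 on $h^1\times h^1$. Multiplicities and Jordan blocks below refer to this operator. Then for every $p\in[0,1)$ the following holds. 1. The eigenvalues are purely imaginary and, independently of $p$, they are exactly the numbers $\Lambda=\pm i\,\Omega_m$, $m\in\mathbb{N}$, where $$\Omega_0=\Omega_1=0,\qquad \Omega_m=\frac{m-1}{m+1}\quad\text{for } m\ge 2.$$ 2. The eigenvalue $\Lambda=0$ has algebraic multiplicity four and geometric multiplicity three; its generalized eigenspace has a Jordan basis with exactly one block of size two and two blocks of size one. 3. Each nonzero eigenvalue $\pm i\,\Omega_m$, $m\ge 2$, is algebraically simple; thus the list in 1 (over all $m$ and both signs) counts every eigenvalue with its multiplicity. -/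

import Mathlib

open scoped ENNReal

noncomputable section

namespace ConformalFlow

/-- The complex Hilbert space `ℓ²(ℕ)`. -/
abbrev Ell2 : Type := lp (fun _ : ℕ => ℂ) 2

/-- The weighted space `h¹` of all `a ∈ ℓ²` with `∑ (n + 1)² |a_n|² < ∞`. -/
def hOne : Submodule ℂ Ell2 where
  carrier := {a | Summable fun n : ℕ => ((n : ℝ) + 1) ^ 2 * ‖a n‖ ^ 2}
  zero_mem' := by simp
  add_mem' := by
    intro a b ha hb
    refine Summable.of_nonneg_of_le (fun n => by positivity) (fun n => ?_)
      ((ha.add hb).mul_left 2)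
    have h1 : ‖(a + b) n‖ ≤ ‖a n‖ + ‖b n‖ := by
      simpa using norm_add_le (a n) (b n)
    have h2 : ‖(a + b) n‖ ^ 2 ≤ 2 * (‖a n‖ ^ 2 + ‖b n‖ ^ 2) := by
      nlinarith [norm_nonneg ((a + b) n), norm_nonneg (a n), norm_nonneg (b n),
        sq_nonneg (‖a n‖ - ‖b n‖)]
    nlinarith [sq_nonneg ((n : ℝ) + 1)]
  smul_mem' := by
    intro c a ha
    refine (ha.mul_left (‖c‖ ^ 2)).congr (fun n => ?_)
    simp only [lp.coeFn_smul, Pi.smul_apply, norm_smul]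
    ring

/-- The interaction coefficients `S_{njkl} = min(n, j, k, l) + 1`. -/
def S (n j k l : ℕ) : ℕ := min (min n j) (min k l) + 1

/-- The `j`-th summand of `(B_± a)_n`, the sum over `0 ≤ k ≤ n + j`;
the sign `±` is `σ ∈ {1, -1}`. -/
def hessianTerm (σ : ℤˣ) (A : ℕ → ℝ) (a : ℕ → ℂ) (n j : ℕ) : ℂ :=
  ∑ k ∈ Finset.range (n + j + 1), (S n j k (n + j - k) : ℂ) *
    (2 * (A j : ℂ) * (A (n + j - k) : ℂ) * a k
      + ((σ : ℤ) : ℂ) * (A k : ℂ) * (A (n + j - k) : ℂ) * a j)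

/-- The action of the Hessian operators `L_±` (sign `σ = ±1`) at a real standing wave `A` with
frequency `lam`:
`(L_± a)_n = ∑_{j ≥ 0} ∑_{k=0}^{n+j} S_{n,j,k,n+j-k} [2 A_j A_{n+j-k} a_k ± A_k A_{n+j-k} a_j]
  - (n + 1) lam a_n`. -/
def hessian (σ : ℤˣ) (A : ℕ → ℝ) (lam : ℝ) (a : ℕ → ℂ) (n : ℕ) : ℂ :=
  (∑' j : ℕ, hessianTerm σ A a n j) - ((n : ℂ) + 1) * (lam : ℂ) * a n

/-- The normalized ground state `A_n(p) = (1 - p²) pⁿ`, a standing wave of frequency `1`. -/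
def groundState (p : ℝ) (n : ℕ) : ℝ := (1 - p ^ 2) * p ^ n

lemma exists_decay (a : hOne) : ∃ C : ℝ, 0 ≤ C ∧ ∀ n : ℕ, ‖a.1 n‖ ≤ C / ((n : ℝ) + 1) := by
  have ha : Summable fun n : ℕ => ((n : ℝ) + 1) ^ 2 * ‖a.1 n‖ ^ 2 := a.2
  refine ⟨√(∑' n : ℕ, ((n : ℝ) + 1) ^ 2 * ‖a.1 n‖ ^ 2), Real.sqrt_nonneg _, fun n => ?_⟩
  rw [le_div_iff₀ (by positivity)]
  apply Real.le_sqrt_of_sq_le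
  have h := ha.le_tsum n (fun m _ => by positivity)
  calc _ = ((n : ℝ) + 1) ^ 2 * ‖a.1 n‖ ^ 2 := by ring
    _ ≤ _ := h

lemma summable_weight (k : ℕ) {p : ℝ} (hp : p ∈ Set.Ico (0 : ℝ) 1) :
    Summable fun n : ℕ => ((n : ℝ) + 1) ^ k * p ^ n := by
  have hp' : ‖p‖ < 1 := by rw [Real.norm_of_nonneg hp.1]; exact hp.2
  have h : ∀ n : ℕ, ((n : ℝ) + 1) ^ k * p ^ n
      = ∑ i ∈ Finset.range (k + 1), (k.choose i : ℝ) * ((n : ℝ) ^ i * p ^ n) := by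
    intro n
    rw [add_pow, Finset.sum_mul]
    refine Finset.sum_congr rfl fun i _ => ?_
    rw [one_pow]; ring
  simp_rw [h]
  exact summable_sum fun i _ => (summable_pow_mul_geometric_of_norm_lt_one i hp').mul_left _

lemma groundState_abs_le {p : ℝ} (hp : p ∈ Set.Ico (0 : ℝ) 1) (n : ℕ) :
    |groundState p n| ≤ p ^ n := by
  have h0 : 0 ≤ p ^ n := pow_nonneg hp.1 n
  have h1 : p ^ 2 < 1 := by nlinarith [hp.1, hp.2]
  have h2 : 0 ≤ 1 - p ^ 2 := by linarith
  rw [groundState, abs_of_nonneg (by positivity)]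
  nlinarith [sq_nonneg p]

lemma exists_hessianTerm_bound (σ : ℤˣ) {p : ℝ} (hp : p ∈ Set.Ico (0 : ℝ) 1) (a : hOne) :
    ∃ D : ℝ, ∀ n j : ℕ, ‖hessianTerm σ (groundState p) a.1 n j‖
      ≤ D / ((n : ℝ) + 1) * (((j : ℝ) + 1) ^ 2 * p ^ j) := by
  obtain ⟨C, hC, hdec⟩ := exists_decay a
  have hp0 : 0 ≤ p := hp.1
  set W : ℝ := ∑' i : ℕ, ((i : ℝ) + 1) ^ 1 * p ^ i with hW
  set K : ℝ := ∑' i : ℕ, ((i : ℝ) + 1) ^ 2 * p ^ i with hK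
  have hW0 : 0 ≤ W := tsum_nonneg fun i => by positivity
  refine ⟨2 * C * W + C * K, fun n j => ?_⟩
  have hn : (0 : ℝ) < (n : ℝ) + 1 := by positivity
  have hj : (1 : ℝ) ≤ (j : ℝ) + 1 := by simp
  have hσ : ‖((σ : ℤ) : ℂ)‖ = 1 := by
    rcases Int.units_eq_one_or σ with h | h <;> simp [h]
  -- termwise estimate
  have hterm : ∀ k ∈ Finset.range (n + j + 1),
      ‖(S n j k (n + j - k) : ℂ) *
        (2 * (groundState p j : ℂ) * (groundState p (n + j - k) : ℂ) * a.1 k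
        + ((σ : ℤ) : ℂ) * (groundState p k : ℂ) * (groundState p (n + j - k) : ℂ) * a.1 j)‖
      ≤ 2 * C * (((j : ℝ) + 1) * p ^ j) / ((n : ℝ) + 1)
          * (((n + j - k : ℕ) : ℝ) + 1) ^ 1 * p ^ (n + j - k)
        + ((j : ℝ) + 1) * p ^ (n + j) * C := by
    intro k hk
    have hk' : k ≤ n + j := by
      have := Finset.mem_range.mp hk
      omega
    have hS : ((S n j k (n + j - k) : ℕ) : ℝ) ≤ (j : ℝ) + 1 := by
      have : S n j k (n + j - k) ≤ j + 1 := by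
        simp only [S]; omega
      exact_mod_cast this
    have e1 : ‖2 * (groundState p j : ℂ) * (groundState p (n + j - k) : ℂ) * a.1 k‖
        ≤ 2 * p ^ j * p ^ (n + j - k) * (C / ((k : ℝ) + 1)) := by
      simp only [norm_mul, Complex.norm_real, Real.norm_eq_abs, Complex.norm_ofNat]
      have h1 := groundState_abs_le hp j
      have h2 := groundState_abs_le hp (n + j - k)
      have h3 := hdec k
      gcongr
    have e2 : ‖((σ : ℤ) : ℂ) * (groundState p k : ℂ) * (groundState p (n + j - k) : ℂ) * a.1 j‖
        ≤ p ^ (n + j) * C := by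
      simp only [norm_mul, Complex.norm_real, Real.norm_eq_abs, hσ, one_mul]
      have h1 := groundState_abs_le hp k
      have h2 := groundState_abs_le hp (n + j - k)
      have h3 : ‖a.1 j‖ ≤ C := (hdec j).trans (div_le_self hC hj)
      have h4 : p ^ (n + j) = p ^ k * p ^ (n + j - k) := by
        rw [← pow_add]; congr 1; omega
      rw [h4]
      gcongr
    have e3 : C / ((k : ℝ) + 1) ≤ C / ((n : ℝ) + 1) * (((n + j - k : ℕ) : ℝ) + 1) := by
      rw [div_mul_eq_mul_div, div_le_div_iff₀ (by positivity) hn]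
      have h5 : ((n + j - k : ℕ) : ℝ) = (n : ℝ) + j - k := by
        rw [Nat.cast_sub hk']; push_cast; ring
      have h6 : (n : ℝ) + 1 ≤ (((n + j - k : ℕ) : ℝ) + 1) * ((k : ℝ) + 1) := by
        have h7 : (0 : ℝ) ≤ ((n + j - k : ℕ) : ℝ) := by positivity
        have h8 : (0 : ℝ) ≤ (k : ℝ) := by positivity
        have h9 : (0 : ℝ) ≤ (j : ℝ) := by positivity
        nlinarith [mul_nonneg h7 h8]
      nlinarith
    rw [norm_mul, Complex.norm_natCast]
    calc _ ≤ ((j : ℝ) + 1) * (2 * p ^ j * p ^ (n + j - k) *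
              (C / ((n : ℝ) + 1) * (((n + j - k : ℕ) : ℝ) + 1)) + p ^ (n + j) * C) := by
            refine mul_le_mul hS ((norm_add_le _ _).trans (add_le_add (e1.trans ?_) e2))
              (norm_nonneg _) (by positivity)
            gcongr
      _ = _ := by ring
  -- summation over `k`
  have hsum1 : ∑ k ∈ Finset.range (n + j + 1),
      (((n + j - k : ℕ) : ℝ) + 1) ^ 1 * p ^ (n + j - k) ≤ W := by
    have := Finset.sum_range_reflect (fun i : ℕ => ((i : ℝ) + 1) ^ 1 * p ^ i) (n + j + 1)
    simp only [Nat.add_sub_cancel] at this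
    rw [this]
    exact (summable_weight 1 hp).sum_le_tsum _ fun i _ => by positivity
  have hKn : ((n : ℝ) + 1) ^ 2 * p ^ n ≤ K :=
    (summable_weight 2 hp).le_tsum n fun i _ => by positivity
  have hA : ‖hessianTerm σ (groundState p) a.1 n j‖
      ≤ 2 * C * (((j : ℝ) + 1) * p ^ j) / ((n : ℝ) + 1) * W
        + ((n : ℝ) + j + 1) * (((j : ℝ) + 1) * p ^ (n + j) * C) := by
    refine (norm_sum_le_of_le _ hterm).trans ?_
    rw [Finset.sum_add_distrib]
    refine add_le_add ?_ ?_
    · simp_rw [mul_assoc (2 * C * (((j : ℝ) + 1) * p ^ j) / ((n : ℝ) + 1))]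
      rw [← Finset.mul_sum]
      gcongr
    · simp
  refine hA.trans ?_
  have hB : 2 * C * (((j : ℝ) + 1) * p ^ j) / ((n : ℝ) + 1) * W
      ≤ 2 * C * W / ((n : ℝ) + 1) * (((j : ℝ) + 1) ^ 2 * p ^ j) := by
    have : 2 * C * (((j : ℝ) + 1) * p ^ j) / ((n : ℝ) + 1) * W
        = 2 * C * W / ((n : ℝ) + 1) * (((j : ℝ) + 1) * p ^ j) := by ring
    rw [this]
    have h2 : (j : ℝ) + 1 ≤ ((j : ℝ) + 1) ^ 2 := by nlinarith
    gcongr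
  have hD : ((n : ℝ) + j + 1) * (((j : ℝ) + 1) * p ^ (n + j) * C)
      ≤ C * K / ((n : ℝ) + 1) * (((j : ℝ) + 1) ^ 2 * p ^ j) := by
    have h1 : (n : ℝ) + j + 1 ≤ ((n : ℝ) + 1) * ((j : ℝ) + 1) := by
      nlinarith [mul_nonneg (Nat.cast_nonneg n : (0 : ℝ) ≤ n) (Nat.cast_nonneg j : (0 : ℝ) ≤ j)]
    calc _ ≤ (((n : ℝ) + 1) * ((j : ℝ) + 1)) * (((j : ℝ) + 1) * p ^ (n + j) * C) := by gcongr
      _ = C * (((n : ℝ) + 1) ^ 2 * p ^ n) / ((n : ℝ) + 1) * (((j : ℝ) + 1) ^ 2 * p ^ j) := by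
          rw [pow_add]; field_simp
      _ ≤ _ := by gcongr
  calc _ ≤ _ := add_le_add hB hD
    _ = _ := by ring

lemma summable_hessianTerm (σ : ℤˣ) {p : ℝ} (hp : p ∈ Set.Ico (0 : ℝ) 1) (a : hOne) (n : ℕ) :
    Summable (hessianTerm σ (groundState p) a.1 n) := by
  obtain ⟨D, hD⟩ := exists_hessianTerm_bound σ hp a
  exact Summable.of_norm_bounded ((summable_weight 2 hp).mul_left _) (hD n)

lemma memℓp_iff_summable (f : ℕ → ℂ) : Memℓp f 2 ↔ Summable fun n => ‖f n‖ ^ 2 := by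
  rw [memℓp_gen_iff (by norm_num)]
  simp

lemma memℓp_weight (a : hOne) : Memℓp (fun n : ℕ => ((n : ℂ) + 1) * a.1 n) 2 := by
  rw [memℓp_iff_summable]
  refine (a.2 : Summable fun n : ℕ => ((n : ℝ) + 1) ^ 2 * ‖a.1 n‖ ^ 2).congr fun n => ?_
  have : ‖((n : ℂ) + 1)‖ = (n : ℝ) + 1 := by
    exact_mod_cast Complex.norm_natCast (n + 1)
  rw [norm_mul, this, mul_pow]

/-- The Hessian operators at the ground state map `h¹` into `ℓ²`. -/
lemma memℓp_hessian (σ : ℤˣ) {p : ℝ} (hp : p ∈ Set.Ico (0 : ℝ) 1) (a : hOne) :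
    Memℓp (hessian σ (groundState p) 1 a.1) 2 := by
  have h1 : Memℓp (fun n : ℕ => ∑' j : ℕ, hessianTerm σ (groundState p) a.1 n j) 2 := by
    rw [memℓp_iff_summable]
    obtain ⟨D, hD⟩ := exists_hessianTerm_bound σ hp a
    have hbd : ∀ n : ℕ, ‖∑' j : ℕ, hessianTerm σ (groundState p) a.1 n j‖
        ≤ D / ((n : ℝ) + 1) * ∑' j : ℕ, ((j : ℝ) + 1) ^ 2 * p ^ j := by
      intro n
      refine tsum_of_norm_bounded ?_ (hD n)
      exact ((summable_weight 2 hp).hasSum).mul_left _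
    have hs : Summable fun n : ℕ => 1 / ((n : ℝ) + 1) ^ 2 := by
      have := (summable_nat_add_iff 1).mpr (Real.summable_one_div_nat_pow.mpr (one_lt_two))
      exact_mod_cast this
    refine Summable.of_nonneg_of_le (fun n => by positivity) (fun n => ?_)
      (hs.mul_left ((D * ∑' j : ℕ, ((j : ℝ) + 1) ^ 2 * p ^ j) ^ 2))
    calc _ ≤ (D / ((n : ℝ) + 1) * ∑' j : ℕ, ((j : ℝ) + 1) ^ 2 * p ^ j) ^ 2 :=
          pow_le_pow_left₀ (norm_nonneg _) (hbd n) 2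
      _ = _ := by field_simp
  have h2 := h1.sub (memℓp_weight a)
  convert h2 using 1
  funext n
  simp [hessian]

/-- The operators `L_±(p) : h¹ ⊂ ℓ² → ℓ²` at the ground state `A(p)`, where the frequency is `1`;
`σ = 1` gives `L_+(p)` and `σ = -1` gives `L_-(p)`. -/
def L (σ : ℤˣ) (p : Set.Ico (0 : ℝ) 1) : hOne →ₗ[ℂ] Ell2 where
  toFun a := ⟨hessian σ (groundState p) 1 a.1, memℓp_hessian σ p.2 a⟩
  map_add' a b := by
    ext n
    have h : hessianTerm σ (groundState p) (a + b).1 n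
        = fun j => hessianTerm σ (groundState p) a.1 n j
          + hessianTerm σ (groundState p) b.1 n j := by
      funext j
      simp only [hessianTerm, ← Finset.sum_add_distrib]
      refine Finset.sum_congr rfl fun k _ => ?_
      simp only [Submodule.coe_add, lp.coeFn_add, Pi.add_apply]
      ring
    simp only [hessian, h, lp.coeFn_add, Pi.add_apply]
    rw [(summable_hessianTerm σ p.2 a n).tsum_add (summable_hessianTerm σ p.2 b n)]
    simp only [Submodule.coe_add, lp.coeFn_add, Pi.add_apply]
    ring
  map_smul' c a := by
    ext n
    have h : hessianTerm σ (groundState p) (c • a).1 n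
        = fun j => c * hessianTerm σ (groundState p) a.1 n j := by
      funext j
      simp only [hessianTerm, Finset.mul_sum]
      refine Finset.sum_congr rfl fun k _ => ?_
      simp only [Submodule.coe_smul, lp.coeFn_smul, Pi.smul_apply, smul_eq_mul]
      ring
    change (∑' j : ℕ, hessianTerm σ (groundState p) (c • a).1 n j) - _ * (c * a.1 n)
      = c * ((∑' j : ℕ, hessianTerm σ (groundState p) a.1 n j) - _ * a.1 n)
    rw [h, tsum_mul_left]
    ring

/-- The diagonal operator `M = diag(1, 2, 3, …)`, a bijection from `h¹` onto `ℓ²`. -/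
def M : hOne ≃ₗ[ℂ] Ell2 where
  toFun a := ⟨fun n => ((n : ℂ) + 1) * a.1 n, memℓp_weight a⟩
  map_add' a b := by
    ext n
    exact mul_add ((n : ℂ) + 1) (a.1 n) (b.1 n)
  map_smul' c a := by
    ext n
    simp only [Submodule.coe_smul, lp.coeFn_smul, Pi.smul_apply, smul_eq_mul, RingHom.id_apply]
    ring
  invFun x :=
    have hx : Summable fun n : ℕ => ‖x n‖ ^ 2 := (memℓp_iff_summable _).mp x.2
    have hn (n : ℕ) : ‖((n : ℂ) + 1)‖ = (n : ℝ) + 1 := by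
      exact_mod_cast Complex.norm_natCast (n + 1)
    have hle (n : ℕ) : ‖x n / ((n : ℂ) + 1)‖ ^ 2 ≤ ‖x n‖ ^ 2 := by
      rw [norm_div, hn]
      exact pow_le_pow_left₀ (by positivity)
        (div_le_self (norm_nonneg _) (by simp)) 2
    ⟨⟨fun n => x n / ((n : ℂ) + 1), (memℓp_iff_summable _).mpr
        (Summable.of_nonneg_of_le (fun n => by positivity) hle hx)⟩, by
      refine hx.congr fun n => ?_
      change _ = ((n : ℝ) + 1) ^ 2 * ‖x n / ((n : ℂ) + 1)‖ ^ 2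
      rw [norm_div, hn]
      field_simp⟩
  left_inv a := by
    ext n
    have : ((n : ℂ) + 1) ≠ 0 := by exact_mod_cast n.succ_ne_zero
    simp [this]
  right_inv x := by
    ext n
    have : ((n : ℂ) + 1) ≠ 0 := by exact_mod_cast n.succ_ne_zero
    simp only
    field_simp

/-- `Λ` is an eigenvalue of the spectral problem `L_- a = Λ M b`, `L_+ b = -Λ M a`. -/
def IsSpectralEigenvalue (p : Set.Ico (0 : ℝ) 1) (Λ : ℂ) : Prop :=
  ∃ a b : hOne, (a, b) ≠ (0, 0) ∧ L (-1) p a = Λ • M b ∧ L 1 p b = -(Λ • M a)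

/-- The operator `(a, b) ↦ (-M⁻¹ L_+ b, M⁻¹ L_- a)` on `h¹ × h¹`: the spectral problem is
its eigenvalue equation, and its generalized eigenvectors are those of the spectral problem. -/
def linearization (p : Set.Ico (0 : ℝ) 1) : Module.End ℂ (hOne × hOne) :=
  LinearMap.prod
    (-(M.symm.toLinearMap ∘ₗ L 1 p ∘ₗ LinearMap.snd ℂ hOne hOne))
    (M.symm.toLinearMap ∘ₗ L (-1) p ∘ₗ LinearMap.fst ℂ hOne hOne)

lemma linearization_eq_smul_iff (p : Set.Ico (0 : ℝ) 1) (Λ : ℂ) (a b : hOne) :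
    linearization p (a, b) = Λ • (a, b) ↔
      L (-1) p a = Λ • M b ∧ L 1 p b = -(Λ • M a) := by
  have h : linearization p (a, b) = (-(M.symm (L 1 p b)), M.symm (L (-1) p a)) := rfl
  rw [h, Prod.smul_mk, Prod.mk.injEq, and_comm, LinearEquiv.symm_apply_eq, map_smul,
    neg_eq_iff_eq_neg, LinearEquiv.symm_apply_eq, map_neg, map_smul]

/-- The frequencies `Ω₀ = Ω₁ = 0` and `Ω_m = (m - 1) / (m + 1)` for `m ≥ 2`. -/
def Omega (m : ℕ) : ℝ := if m ≤ 1 then 0 else ((m : ℝ) - 1) / ((m : ℝ) + 1)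

end ConformalFlow

end

noncomputable section

namespace ConformalFlow

/-! At the ground state `L_± = 2T ± R - M`. Here `T` has entries `p^|n-k| - p^(n+k+2)`
(`hasSum_greenKernel`), and `R` has rank one because `A_k A_{n+j-k}` does not depend on `k`
(`sum_S`, `hessian_groundState`). The matrix `T` inverts a Jacobi matrix up to the factor `1 - p²`.
Passing to `g_a(z) = ∑ a_n z^(n+1)`, the identity `b = M⁻¹ T a` becomes `(z - p)(1 - p z) g_b' = (1
- p²) g_a - const` (`JacobiRel.hasSum`).

The coefficient of `g_b'` vanishes at `z = p`, so `M⁻¹ T` is lower triangular in the jets of `g_a`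
at `p`, with diagonal `1/(r+1)` (`jet_greenOp`). Its eigenvectors come from the powers `w^(m+1)` of
`w = (z - p)/(1 - p z)` (`greenOp_eigenVec`). The functional in `R` is the jet of lowest order, and
its range is spanned by `M A`, so both `M⁻¹ L_±` stay triangular. Hence the square of the
linearization multiplies a leading jet of order `r` by `-Ω_r²` (`JetVanish.linearization_sq`).

Jets at `p` determine a sequence by the identity theorem. So a generalized eigenvector can start
only at an order `r` with `Λ² = -Ω_r²`, and subtracting explicit eigenvectors exhausts the
generalized eigenspaces. No completeness of eigenvectors or compactness is needed. -/

lemma _root_.HasSum.congr_eq {α β : Type*} [AddCommMonoid α] [TopologicalSpace α] {f g : β → α}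
    {a b : α} (h : HasSum f a) (hfg : ∀ i, g i = f i) (hab : b = a) : HasSum g b := by
  rw [hab, funext hfg]; exact h

/-! ### Sums of the interaction coefficients -/

lemma S_succ (n j k l : ℕ) : S (n + 1) (j + 1) (k + 1) (l + 1) = S n j k l + 1 := by
  simp only [S]; omega

/-- The two end terms `k = 0` and `k = n + j` equal 1; removing them lowers all four indices by one,
which gives the induction. -/
lemma sum_S (n j : ℕ) :
    ∑ k ∈ Finset.range (n + j + 1), S n j k (n + j - k) = (n + 1) * (j + 1) := by
  induction n generalizing j with
  | zero =>
    have h : ∀ k ∈ Finset.range (0 + j + 1), S 0 j k (0 + j - k) = 1 := fun k _ => by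
      simp [S]
    rw [Finset.sum_congr rfl h]; simp
  | succ n ih =>
    cases j with
    | zero =>
      have h : ∀ k ∈ Finset.range (n + 1 + 0 + 1), S (n + 1) 0 k (n + 1 + 0 - k) = 1 :=
        fun k _ => by simp [S]
      rw [Finset.sum_congr rfl h]; simp
    | succ j =>
      have h : ∀ k ∈ Finset.range (n + j + 1),
          S (n + 1) (j + 1) (k + 1) (n + 1 + (j + 1) - (k + 1)) = S n j k (n + j - k) + 1 := by
        intro k hk
        rw [← S_succ]
        have := Finset.mem_range.mp hk
        congr 1; omega
      have e : n + 1 + (j + 1) + 1 = (n + j + 1) + 1 + 1 := by omega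
      rw [e, Finset.sum_range_succ, Finset.sum_range_succ', Finset.sum_congr rfl h,
        Finset.sum_add_distrib, ih j]
      have h0 : S (n + 1) (j + 1) (n + j + 1 + 1) (n + 1 + (j + 1) - (n + j + 1 + 1)) = 1 := by
        simp only [S]; omega
      have h1 : S (n + 1) (j + 1) 0 (n + 1 + (j + 1) - 0) = 1 := by
        simp [S]
      rw [h0, h1]
      simp only [Finset.sum_const, Finset.card_range, smul_eq_mul, mul_one]
      ring

/-! ### The Green kernel and the closed form of the Hessian operators -/

/-- The kernel `p ^ |n - k| - p ^ (n + k + 2)`, Green's function of a Jacobi matrix. -/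
def greenKernel (p : ℝ) (n k : ℕ) : ℝ :=
  p ^ ((k - n) + (n - k)) * (1 - (p ^ 2) ^ (min n k + 1))

/-- Raising `k` by one adds only the geometric tail over `j ≥ k + 1`. -/
lemma hasSum_min_succ_mul_pow {x : ℝ} (h0 : 0 ≤ x) (h1 : x < 1) (k : ℕ) :
    HasSum (fun j : ℕ => (1 - x) ^ 2 * (((min j k : ℕ) : ℝ) + 1) * x ^ j) (1 - x ^ (k + 1)) := by
  have hne : 1 - x ≠ 0 := by linarith
  induction k with
  | zero =>
    have := (hasSum_geometric_of_lt_one h0 h1).mul_left ((1 - x) ^ 2)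
    refine this.congr_eq (fun j => by simp) ?_
    field_simp; ring
  | succ k ih =>
    have h : HasSum (fun j : ℕ => if j < k + 1 then 0 else (1 - x) ^ 2 * x ^ j)
        ((1 - x) * x ^ (k + 1)) := by
      rw [← hasSum_nat_add_iff' (k + 1)]
      have h2 := (hasSum_geometric_of_lt_one h0 h1).mul_left ((1 - x) ^ 2 * x ^ (k + 1))
      refine h2.congr_eq (fun j => ?_) ?_
      · rw [if_neg (by omega), pow_add]; ring
      · rw [Finset.sum_eq_zero fun i hi => if_pos (Finset.mem_range.mp hi)]
        field_simp; ring
    refine (ih.add h).congr_eq (fun j => ?_) ?_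
    · split_ifs with hj
      · rw [min_eq_left (by omega), min_eq_left (by omega), add_zero]
      · rw [min_eq_right (by omega), min_eq_right (by omega)]; push_cast; ring
    · ring

lemma hasSum_greenKernel {p : ℝ} (hp : p ∈ Set.Ico (0 : ℝ) 1) (n k : ℕ) :
    HasSum (fun j : ℕ => if k ≤ n + j then
      (S n j k (n + j - k) : ℝ) * (groundState p j * groundState p (n + j - k)) else 0)
      (greenKernel p n k) := by
  have hp2 : p ^ 2 < 1 := by nlinarith [hp.1, hp.2]
  -- The terms with `j < k - n` vanish. After the shift the coefficient is `min j (min n k) + 1` and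
  -- the powers combine to `p^|n-k| p^(2j)`.
  rw [← hasSum_nat_add_iff' (k - n)]
  rw [Finset.sum_eq_zero fun i hi => if_neg (by have := Finset.mem_range.mp hi; omega), sub_zero]
  refine ((hasSum_min_succ_mul_pow (sq_nonneg p) hp2 (min n k)).mul_left
    (p ^ ((k - n) + (n - k)))).congr_eq (fun j => ?_) rfl
  rw [if_pos (by omega)]
  have e1 : S n (j + (k - n)) k (n + (j + (k - n)) - k) = min j (min n k) + 1 := by
    simp only [S]; omega
  have e2 : n + (j + (k - n)) - k = j + (n - k) := by omega
  rw [e1, e2, groundState, groundState, ← pow_mul, two_mul, pow_add, pow_add, pow_add, pow_add]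
  push_cast; ring

lemma abs_greenKernel_le {p : ℝ} (hp : p ∈ Set.Ico (0 : ℝ) 1) (n k : ℕ) :
    |greenKernel p n k| ≤ p ^ (k - n) := by
  have hp2 : p ^ 2 ≤ 1 := by nlinarith [hp.1, hp.2]
  have h1 : (p ^ 2) ^ (min n k + 1) ≤ 1 := pow_le_one₀ (sq_nonneg p) hp2
  have h2 : 0 ≤ (p ^ 2) ^ (min n k + 1) := by positivity
  have h3 : p ^ (n - k) ≤ 1 := pow_le_one₀ hp.1 hp.2.le
  have h4 := pow_nonneg hp.1 (n - k)
  have h5 := pow_nonneg hp.1 (k - n)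
  rw [greenKernel, abs_mul, abs_of_nonneg (pow_nonneg hp.1 _),
    abs_of_nonneg (by linarith : 0 ≤ 1 - (p ^ 2) ^ (min n k + 1)), pow_add]
  have : p ^ (n - k) * (1 - (p ^ 2) ^ (min n k + 1)) ≤ 1 := by nlinarith
  nlinarith

lemma summable_greenKernel_mul {p : ℝ} (hp : p ∈ Set.Ico (0 : ℝ) 1) {a : ℕ → ℂ} {C : ℝ}
    (ha : ∀ k, ‖a k‖ ≤ C) (n : ℕ) : Summable fun k => (greenKernel p n k : ℂ) * a k := by
  rw [← summable_nat_add_iff n]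
  refine Summable.of_norm_bounded (g := fun k => p ^ k * C)
    ((summable_geometric_of_lt_one hp.1 hp.2).mul_right C) fun k => ?_
  rw [norm_mul, Complex.norm_real, Real.norm_eq_abs]
  have h := abs_greenKernel_le hp n (k + n)
  rw [Nat.add_sub_cancel] at h
  exact mul_le_mul h (ha _) (norm_nonneg _) (pow_nonneg hp.1 _)

lemma greenKernel_zero (p : ℝ) (k : ℕ) :
    (1 + p ^ 2) * greenKernel p 0 k - p * greenKernel p 1 k
      = if k = 0 then 1 - p ^ 2 else 0 := by
  rcases k with _ | k
  · simp [greenKernel]; ring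
  · simp only [greenKernel]
    rw [if_neg (by omega), min_eq_left (by omega), min_eq_left (by omega),
      show k + 1 - 0 + (0 - (k + 1)) = k + 1 by omega, show k + 1 - 1 + (1 - (k + 1)) = k by omega]
    ring

/-- For `p ≠ 0` the kernel is, on each side of the diagonal, a combination of `p^n` and `p^(-n)`,
which the recurrence annihilates; the corner at the diagonal produces the source `1 - p²`. The
algebra below also covers `p = 0`. -/
lemma greenKernel_succ (p : ℝ) (n k : ℕ) :
    (1 + p ^ 2) * greenKernel p (n + 1) k - p * greenKernel p n k - p * greenKernel p (n + 2) k
      = if k = n + 1 then 1 - p ^ 2 else 0 := by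
  simp only [greenKernel]
  rcases lt_trichotomy k (n + 1) with h | rfl | h
  · obtain ⟨d, rfl⟩ : ∃ d, n = k + d := ⟨n - k, by omega⟩
    rw [if_neg (by omega), min_eq_right (by omega), min_eq_right (by omega),
      min_eq_right (by omega), show k - (k + d + 1) + (k + d + 1 - k) = d + 1 by omega,
      show k - (k + d) + (k + d - k) = d by omega,
      show k - (k + d + 2) + (k + d + 2 - k) = d + 2 by omega]
    ring
  · rw [if_pos rfl, min_self, min_eq_left (by omega), min_eq_right (by omega),
      show n + 1 - (n + 1) + (n + 1 - (n + 1)) = 0 by omega,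
      show n + 1 - n + (n - (n + 1)) = 1 by omega,
      show n + 1 - (n + 2) + (n + 2 - (n + 1)) = 1 by omega]
    ring
  · obtain ⟨d, rfl⟩ : ∃ d, k = n + 2 + d := ⟨k - (n + 2), by omega⟩
    rw [if_neg (by omega), min_eq_left (by omega), min_eq_left (by omega),
      min_eq_left (by omega), show n + 2 + d - (n + 1) + (n + 1 - (n + 2 + d)) = d + 1 by omega,
      show n + 2 + d - n + (n - (n + 2 + d)) = d + 2 by omega,
      show n + 2 + d - (n + 2) + (n + 2 - (n + 2 + d)) = d by omega]
    ring

lemma greenSum_zero {p : ℝ} (hp : p ∈ Set.Ico (0 : ℝ) 1) {a : ℕ → ℂ} {C : ℝ}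
    (ha : ∀ k, ‖a k‖ ≤ C) :
    (1 + (p : ℂ) ^ 2) * (∑' k, (greenKernel p 0 k : ℂ) * a k)
      - p * (∑' k, (greenKernel p 1 k : ℂ) * a k) = (1 - (p : ℂ) ^ 2) * a 0 := by
  have h := fun n => (summable_greenKernel_mul hp ha n).hasSum
  refine (((h 0).mul_left _).sub ((h 1).mul_left _)).unique ?_
  refine (hasSum_ite_eq 0 ((1 - (p : ℂ) ^ 2) * a 0)).congr_eq (fun k => ?_) rfl
  rw [← mul_assoc, ← mul_assoc, ← sub_mul]
  have := congrArg (fun x : ℝ => (x : ℂ)) (greenKernel_zero p k)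
  push_cast at this
  rw [this]
  split_ifs with hk
  · subst hk; push_cast; rfl
  · simp

lemma greenSum_succ {p : ℝ} (hp : p ∈ Set.Ico (0 : ℝ) 1) {a : ℕ → ℂ} {C : ℝ}
    (ha : ∀ k, ‖a k‖ ≤ C) (n : ℕ) :
    (1 + (p : ℂ) ^ 2) * (∑' k, (greenKernel p (n + 1) k : ℂ) * a k)
      - p * (∑' k, (greenKernel p n k : ℂ) * a k)
      - p * (∑' k, (greenKernel p (n + 2) k : ℂ) * a k) = (1 - (p : ℂ) ^ 2) * a (n + 1) := by
  have h := fun n => (summable_greenKernel_mul hp ha n).hasSum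
  refine ((((h (n + 1)).mul_left _).sub ((h n).mul_left _)).sub ((h (n + 2)).mul_left _)).unique ?_
  refine (hasSum_ite_eq (n + 1) ((1 - (p : ℂ) ^ 2) * a (n + 1))).congr_eq (fun k => ?_) rfl
  rw [← mul_assoc, ← mul_assoc, ← mul_assoc, ← sub_mul, ← sub_mul]
  have := congrArg (fun x : ℝ => (x : ℂ)) (greenKernel_succ p n k)
  push_cast at this
  rw [this]
  split_ifs with hk
  · subst hk; push_cast; rfl
  · simp

lemma summable_pow_mul_of_bounded {p : ℝ} (hp : p ∈ Set.Ico (0 : ℝ) 1) {a : ℕ → ℂ} {C : ℝ}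
    (ha : ∀ k, ‖a k‖ ≤ C) : Summable fun j : ℕ => ((j : ℂ) + 1) * (p : ℂ) ^ j * a j := by
  refine Summable.of_norm_bounded ((summable_weight 1 hp).mul_right C) fun j => ?_
  have : ‖((j : ℂ) + 1)‖ = (j : ℝ) + 1 := by exact_mod_cast Complex.norm_natCast (j + 1)
  rw [norm_mul, norm_mul, this, norm_pow, Complex.norm_real, Real.norm_of_nonneg hp.1, pow_one]
  exact mul_le_mul_of_nonneg_left (ha j) (mul_nonneg (by positivity) (pow_nonneg hp.1 j))

/-- Fubini for the double sum: `S ≤ n + 1` and `|A_j| ≤ p^j` bound row `j`, which has `n + j + 1`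
terms, by a multiple of `(j + 1) p^j`, and the column sums are the Green kernel. -/
lemma hasSum_hessianTerm_fst {p : ℝ} (hp : p ∈ Set.Ico (0 : ℝ) 1) {a : ℕ → ℂ} {C : ℝ}
    (ha : ∀ k, ‖a k‖ ≤ C) (n : ℕ) :
    HasSum (fun j => ∑ k ∈ Finset.range (n + j + 1), (S n j k (n + j - k) : ℂ) *
      (2 * (groundState p j : ℂ) * (groundState p (n + j - k) : ℂ) * a k))
      (2 * ∑' k, (greenKernel p n k : ℂ) * a k) := by
  have hC : 0 ≤ C := (norm_nonneg _).trans (ha 0)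
  set w : ℕ → ℕ → ℝ := fun j k => if k ≤ n + j then
      (S n j k (n + j - k) : ℝ) * (groundState p j * groundState p (n + j - k)) else 0 with hw
  have hfin : ∀ j k, k ∉ Finset.range (n + j + 1) → w j k = 0 := fun j k hk => by
    simp only [hw]; rw [if_neg]; simpa [Nat.lt_succ_iff] using hk
  have hbd : ∀ j k, ‖(w j k : ℂ) * a k‖ ≤ ((n : ℝ) + 1) * p ^ j * C := fun j k => by
    rw [norm_mul, Complex.norm_real, Real.norm_eq_abs]
    refine mul_le_mul ?_ (ha k) (norm_nonneg _)
      (mul_nonneg (by positivity) (pow_nonneg hp.1 j))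
    simp only [hw]
    split_ifs with h
    · rw [abs_mul, abs_mul, Nat.abs_cast]
      have h1 : ((S n j k (n + j - k) : ℕ) : ℝ) ≤ (n : ℝ) + 1 := by
        have : S n j k (n + j - k) ≤ n + 1 := by simp only [S]; omega
        exact_mod_cast this
      have h2 : |groundState p j| * |groundState p (n + j - k)| ≤ p ^ j * 1 :=
        mul_le_mul (groundState_abs_le hp j)
          ((groundState_abs_le hp _).trans (pow_le_one₀ hp.1 hp.2.le)) (abs_nonneg _)
          (pow_nonneg hp.1 j)
      rw [mul_one] at h2
      exact mul_le_mul h1 h2 (by positivity) (by positivity)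
    · rw [abs_zero]; exact mul_nonneg (by positivity) (pow_nonneg hp.1 j)
  have hsum : Summable (Function.uncurry fun j k => (w j k : ℂ) * a k) := by
    refine Summable.of_norm ?_
    rw [summable_prod_of_nonneg fun x => norm_nonneg _]
    have hs : ∀ j, Summable fun k => ‖(w j k : ℂ) * a k‖ := fun j =>
      summable_of_ne_finset_zero (s := Finset.range (n + j + 1)) fun k hk => by
        simp [hfin j k hk]
    refine ⟨hs, ?_⟩
    refine Summable.of_nonneg_of_le (fun j => tsum_nonneg fun k => norm_nonneg _) (fun j => ?_)
      ((summable_weight 1 hp).mul_left (((n : ℝ) + 1) ^ 2 * C))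
    change ∑' k, ‖(w j k : ℂ) * a k‖ ≤ _
    rw [tsum_eq_sum (s := Finset.range (n + j + 1)) fun k hk => by simp [hfin j k hk]]
    refine (Finset.sum_le_card_nsmul _ _ _ fun k _ => hbd j k).trans ?_
    rw [Finset.card_range, nsmul_eq_mul]
    push_cast
    have h3 : (n : ℝ) + j + 1 ≤ ((n : ℝ) + 1) * (j + 1) := by
      nlinarith [mul_nonneg (Nat.cast_nonneg n : (0 : ℝ) ≤ n) (Nat.cast_nonneg j : (0 : ℝ) ≤ j)]
    calc ((n : ℝ) + j + 1) * (((n : ℝ) + 1) * p ^ j * C)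
        ≤ (((n : ℝ) + 1) * (j + 1)) * (((n : ℝ) + 1) * p ^ j * C) :=
          mul_le_mul_of_nonneg_right h3
            (mul_nonneg (mul_nonneg (by positivity) (pow_nonneg hp.1 j)) hC)
      _ = _ := by ring
  have hrow : ∀ j, ∑' k, (w j k : ℂ) * a k = ∑ k ∈ Finset.range (n + j + 1),
      (S n j k (n + j - k) : ℂ) *
        ((groundState p j : ℂ) * (groundState p (n + j - k) : ℂ) * a k) := fun j => by
    rw [tsum_eq_sum (s := Finset.range (n + j + 1)) fun k hk => by simp [hfin j k hk]]
    refine Finset.sum_congr rfl fun k hk => ?_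
    simp only [hw]
    rw [if_pos (by have := Finset.mem_range.mp hk; omega)]
    push_cast; ring
  have hcol : ∀ k, ∑' j, (w j k : ℂ) * a k = (greenKernel p n k : ℂ) * a k := fun k => by
    rw [tsum_mul_right, ← Complex.ofReal_tsum, (hasSum_greenKernel hp n k).tsum_eq]
  have h1 : HasSum (fun j => ∑' k, (w j k : ℂ) * a k) (∑' k, (greenKernel p n k : ℂ) * a k) := by
    have h2 := hsum.prod.hasSum
    have h3 := hsum.tsum_comm
    simp only [Function.uncurry] at h2 h3
    rw [← h3] at h2
    simpa only [hcol] using h2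
  refine (h1.mul_left 2).congr_eq (fun j => ?_) rfl
  rw [hrow, Finset.mul_sum]
  exact Finset.sum_congr rfl fun k _ => by ring

lemma hessian_groundState (σ : ℤˣ) {p : ℝ} (hp : p ∈ Set.Ico (0 : ℝ) 1) {a : ℕ → ℂ} {C : ℝ}
    (ha : ∀ k, ‖a k‖ ≤ C) (n : ℕ) :
    hessian σ (groundState p) 1 a n = 2 * (∑' k, (greenKernel p n k : ℂ) * a k)
      + ((σ : ℤ) : ℂ) * ((1 - (p : ℂ) ^ 2) ^ 2 * (((n : ℂ) + 1) * (p : ℂ) ^ n *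
          ∑' j : ℕ, ((j : ℂ) + 1) * (p : ℂ) ^ j * a j)) - ((n : ℂ) + 1) * a n := by
  have h1 := hasSum_hessianTerm_fst hp ha n
  have h2 := (summable_pow_mul_of_bounded hp ha).hasSum.mul_left
    (((σ : ℤ) : ℂ) * ((1 - (p : ℂ) ^ 2) ^ 2 * (((n : ℂ) + 1) * (p : ℂ) ^ n)))
  have h3 : HasSum (hessianTerm σ (groundState p) a n)
      (2 * (∑' k, (greenKernel p n k : ℂ) * a k)
      + ((σ : ℤ) : ℂ) * ((1 - (p : ℂ) ^ 2) ^ 2 * (((n : ℂ) + 1) * (p : ℂ) ^ n)) *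
          ∑' j : ℕ, ((j : ℂ) + 1) * (p : ℂ) ^ j * a j) := by
    refine (h1.add h2).congr_eq (fun j => ?_) rfl
    have hS : (∑ k ∈ Finset.range (n + j + 1), (S n j k (n + j - k) : ℂ))
        = ((n : ℂ) + 1) * ((j : ℂ) + 1) := by
      exact_mod_cast sum_S n j
    have h4 : ∑ k ∈ Finset.range (n + j + 1), (S n j k (n + j - k) : ℂ) *
        (((σ : ℤ) : ℂ) * (groundState p k : ℂ) * (groundState p (n + j - k) : ℂ) * a j)
        = (((n : ℂ) + 1) * ((j : ℂ) + 1)) *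
          (((σ : ℤ) : ℂ) * ((1 - (p : ℂ) ^ 2) ^ 2 * (p : ℂ) ^ (n + j)) * a j) := by
      rw [← hS, Finset.sum_mul]
      refine Finset.sum_congr rfl fun k hk => ?_
      have h5 : (p : ℂ) ^ (n + j) = (p : ℂ) ^ k * (p : ℂ) ^ (n + j - k) := by
        rw [← pow_add]; congr 1; have := Finset.mem_range.mp hk; omega
      rw [h5, groundState, groundState]
      push_cast; ring
    simp only [hessianTerm, mul_add, Finset.sum_add_distrib]
    simp only [mul_add] at h4
    rw [h4, pow_add]; ring
  rw [hessian, h3.tsum_eq]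
  push_cast; ring

/-! ### Generating functions on the unit disc -/

/-- The generating function `∑ aₙ z ^ (n + 1)` of a sequence. -/
def genFun (a : ℕ → ℂ) (z : ℂ) : ℂ := ∑' n : ℕ, a n * z ^ (n + 1)

lemma ofReal_mem_ball {p : ℝ} (hp : p ∈ Set.Ico (0 : ℝ) 1) :
    (p : ℂ) ∈ Metric.ball (0 : ℂ) 1 := by
  rw [mem_ball_zero_iff, Complex.norm_real, Real.norm_of_nonneg hp.1]
  exact hp.2

lemma summable_mul_pow_of_bounded {a : ℕ → ℂ} {C : ℝ} (ha : ∀ n, ‖a n‖ ≤ C) {z : ℂ}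
    (hz : z ∈ Metric.ball (0 : ℂ) 1) : Summable fun n => a n * z ^ n := by
  rw [mem_ball_zero_iff] at hz
  refine Summable.of_norm_bounded ((summable_geometric_of_lt_one (norm_nonneg z) hz).mul_left C)
    fun n => ?_
  rw [norm_mul, norm_pow]
  exact mul_le_mul_of_nonneg_right (ha n) (by positivity)

lemma summable_genFun {a : ℕ → ℂ} {C : ℝ} (ha : ∀ n, ‖a n‖ ≤ C) {z : ℂ}
    (hz : z ∈ Metric.ball (0 : ℂ) 1) : Summable fun n => a n * z ^ (n + 1) :=
  ((summable_mul_pow_of_bounded ha hz).mul_right z).congr fun n => by rw [pow_succ]; ring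

lemma hasDerivAt_genFun {a : ℕ → ℂ} {C : ℝ} (ha : ∀ n, ‖a n‖ ≤ C) {z : ℂ}
    (hz : z ∈ Metric.ball (0 : ℂ) 1) :
    HasDerivAt (genFun a) (∑' n : ℕ, ((n : ℂ) + 1) * a n * z ^ n) z := by
  have hz' := mem_ball_zero_iff.mp hz
  obtain ⟨r, hr1, hr2⟩ := exists_between hz'
  have hr0 : 0 ≤ r := (norm_nonneg z).trans hr1.le
  have h0 : (0 : ℂ) ∈ Metric.ball (0 : ℂ) r := by
    rw [mem_ball_zero_iff, norm_zero]; exact (norm_nonneg z).trans_lt hr1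
  -- Termwise differentiation takes place on a smaller disc of radius `r < 1`, where the derivatives
  -- have a summable bound.
  refine hasDerivAt_tsum_of_isPreconnected (t := Metric.ball (0 : ℂ) r) (y₀ := 0)
    (g := fun n w => a n * w ^ (n + 1)) (g' := fun n w => ((n : ℂ) + 1) * a n * w ^ n)
    ((summable_weight 1 ⟨hr0, hr2⟩).mul_right C) Metric.isOpen_ball
    (convex_ball _ _).isPreconnected (fun n w _ => ?_) (fun n w hw => ?_) h0 ?_
    (mem_ball_zero_iff.mpr hr1)
  · refine ((hasDerivAt_pow (n + 1) w).const_mul (a n)).congr_deriv ?_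
    rw [Nat.add_sub_cancel]; push_cast; ring
  · have hn : ‖((n : ℂ) + 1)‖ = (n : ℝ) + 1 := by exact_mod_cast Complex.norm_natCast (n + 1)
    rw [norm_mul, norm_mul, norm_pow, hn, pow_one]
    rw [mem_ball_zero_iff] at hw
    have h1 : ‖w‖ ^ n ≤ r ^ n := pow_le_pow_left₀ (norm_nonneg w) hw.le n
    calc ((n : ℝ) + 1) * ‖a n‖ * ‖w‖ ^ n ≤ ((n : ℝ) + 1) * C * r ^ n := by
          gcongr
          · exact mul_nonneg (by positivity) ((norm_nonneg _).trans (ha n))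
          · exact ha n
      _ = _ := by ring
  · simp

lemma analyticOnNhd_genFun {a : ℕ → ℂ} {C : ℝ} (ha : ∀ n, ‖a n‖ ≤ C) :
    AnalyticOnNhd ℂ (genFun a) (Metric.ball 0 1) :=
  DifferentiableOn.analyticOnNhd
    (fun _ hz => (hasDerivAt_genFun ha hz).differentiableAt.differentiableWithinAt)
    Metric.isOpen_ball

lemma eq_zero_of_genFun_eqOn_zero {a : ℕ → ℂ} {C : ℝ} (ha : ∀ n, ‖a n‖ ≤ C)
    (h : Set.EqOn (genFun a) 0 (Metric.ball 0 1)) (n : ℕ) : a n = 0 := by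
  -- The generating function has no constant term, so as an ordinary power series its coefficients
  -- are `a` shifted by one.
  set c : ℕ → ℂ := fun n => Nat.casesOn n 0 a with hc
  have hcC : ∀ n, ‖c n‖ ≤ C := fun n => by
    cases n with
    | zero => simpa [hc] using (norm_nonneg _).trans (ha 0)
    | succ n => exact ha n
  have hrad : 0 < (FormalMultilinearSeries.ofScalars ℂ c).radius := by
    refine lt_of_lt_of_le one_pos ?_
    refine FormalMultilinearSeries.le_radius_of_bound _ C (r := 1) fun n => ?_
    rw [FormalMultilinearSeries.ofScalars_norm]
    simpa using hcC n
  have hps := (FormalMultilinearSeries.hasFPowerSeriesOnBall _ hrad).hasFPowerSeriesAt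
  have hev : (FormalMultilinearSeries.ofScalars ℂ c).sum =ᶠ[nhds 0] 0 := by
    filter_upwards [Metric.ball_mem_nhds (0 : ℂ) one_pos] with z hz
    have h1 : (FormalMultilinearSeries.ofScalars ℂ c).sum z = ∑' n, c n * z ^ n :=
      FormalMultilinearSeries.ofScalars_sum_eq c z
    rw [h1, (summable_mul_pow_of_bounded hcC hz).tsum_eq_zero_add]
    have h2 : c 0 * z ^ 0 = 0 := by simp [hc]
    rw [h2, zero_add]
    exact h hz
  have h3 := (hps.congr hev).eq_zero
  have h4 := FormalMultilinearSeries.ofScalars_series_eq_zero (𝕜 := ℂ) (E := ℂ) (c := c)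
  exact congrFun (h4.mp h3) (n + 1)

/-- The identity theorem applied to the derivative. The derivative of order zero is not required,
because the generating function already vanishes at the origin. -/
lemma eq_zero_of_iteratedDeriv_genFun {a : ℕ → ℂ} {C : ℝ} (ha : ∀ n, ‖a n‖ ≤ C) {z : ℂ}
    (hz : z ∈ Metric.ball (0 : ℂ) 1) (h : ∀ r, iteratedDeriv (r + 1) (genFun a) z = 0) (n : ℕ) :
    a n = 0 := by
  have han := analyticOnNhd_genFun ha
  have hdan := han.deriv
  have hord : analyticOrderAt (deriv (genFun a)) z = ⊤ := by
    rw [ENat.eq_top_iff_forall_ge]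
    intro m
    rw [natCast_le_analyticOrderAt_iff_iteratedDeriv_eq_zero (hdan z hz)]
    intro i _
    rw [← iteratedDeriv_succ']
    exact h i
  have hd0 := hdan.eqOn_zero_of_preconnected_of_eventuallyEq_zero
    (convex_ball _ _).isPreconnected hz (analyticOrderAt_eq_top.mp hord)
  refine eq_zero_of_genFun_eqOn_zero ha (fun w hw => ?_) n
  have h1 := (convex_ball (0 : ℂ) 1).is_const_of_fderivWithin_eq_zero (𝕜 := ℂ)
    (fun x hx => (han x hx).differentiableAt.differentiableWithinAt) (fun x hx => ?_)
    hw (Metric.mem_ball_self one_pos)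
  · rw [h1]; simp [genFun]
  · rw [fderivWithin_of_isOpen Metric.isOpen_ball hx]
    ext
    simpa using hd0 hx

/-! ### The tridiagonal relation as a differential equation at `p` -/

/-- The tridiagonal relation `(1 + p²) yₙ - p yₙ₋₁ - p yₙ₊₁ = fₙ` with `y₋₁ = 0`. -/
def JacobiRel (p : ℝ) (y f : ℕ → ℂ) : Prop :=
  (1 + (p : ℂ) ^ 2) * y 0 - p * y 1 = f 0 ∧
    ∀ n, (1 + (p : ℂ) ^ 2) * y (n + 1) - p * y n - p * y (n + 2) = f (n + 1)

/-- The Jacobi matrix has symbol `(1 + p²) z - p - p z² = (z - p)(1 - p z)`, written here in powers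
of `z - p` so that jets at `p` can be read off. The term `p y₀` corrects for the missing index `-1`.
-/
lemma JacobiRel.hasSum {p : ℝ} {y f : ℕ → ℂ} (h : JacobiRel p y f) {C : ℝ}
    (hy : ∀ n, ‖y n‖ ≤ C) {z : ℂ} (hz : z ∈ Metric.ball (0 : ℂ) 1) :
    HasSum (fun n => f n * z ^ (n + 1))
      ((z - p) * (((1 - (p : ℂ) ^ 2) - p * (z - p)) * ∑' n, y n * z ^ n) + p * y 0) := by
  set s := ∑' n, y n * z ^ n
  have h0 : HasSum (fun n => y n * z ^ n) s := (summable_mul_pow_of_bounded hy hz).hasSum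
  have h1 : HasSum (fun n => y (n + 1) * z ^ (n + 1)) (s - y 0) := by
    have := (hasSum_nat_add_iff' 1).mpr h0
    simpa using this
  set u : ℕ → ℂ := fun n => Nat.casesOn n 0 fun m => y m * z ^ (m + 2)
  have h2 : HasSum u (z ^ 2 * s) := by
    rw [← hasSum_nat_add_iff' 1]
    refine (h0.mul_left (z ^ 2)).congr_eq (fun n => ?_) (by simp [u])
    change y n * z ^ (n + 2) = _
    rw [pow_add]; ring
  have h3 := ((h0.mul_left ((1 + (p : ℂ) ^ 2) * z)).sub (h1.mul_left (p : ℂ))).sub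
    (h2.mul_left (p : ℂ))
  refine h3.congr_eq (fun n => ?_) (by ring)
  cases n with
  | zero =>
    have hu : u 0 = 0 := rfl
    rw [← h.1, hu]; ring
  | succ n =>
    have hu : u (n + 1) = y n * z ^ (n + 2) := rfl
    rw [← h.2 n, hu]; ring

lemma iteratedDeriv_sub_const_self (i : ℕ) (x : ℂ) :
    iteratedDeriv i (fun z : ℂ => z - x) x = if i = 1 then 1 else 0 := by
  rcases i with _ | i
  · simp
  · rw [iteratedDeriv_succ', show (deriv fun z : ℂ => z - x) = fun _ => 1 by funext z; simp,
      iteratedDeriv_const]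
    simp

/-- In the Leibniz formula only the first derivative of `z - x` survives at `x`. The truncated `r -
1` at `r = 0` is harmless, being multiplied by `r`. -/
lemma iteratedDeriv_sub_mul {h : ℂ → ℂ} {x : ℂ} (hh : AnalyticAt ℂ h x) (r : ℕ) :
    iteratedDeriv r (fun z => (z - x) * h z) x = r * iteratedDeriv (r - 1) h x := by
  rw [iteratedDeriv_fun_mul (by fun_prop) hh.contDiffAt]
  simp only [iteratedDeriv_sub_const_self]
  rcases r with _ | r
  · simp
  · rw [Finset.sum_eq_single 1]
    · simp
    · intro b _ hb; simp [hb]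
    · intro hb; simp at hb

/-- The derivatives at `p` of the generating function characterize the sequence; the relation
`q g_b' = c g_a - const` makes `M⁻¹ T` lower triangular in them. -/
lemma JacobiRel.iteratedDeriv_genFun {p : ℝ} (hp : p ∈ Set.Ico (0 : ℝ) 1) {a b : ℕ → ℂ} {C : ℝ}
    (ha : ∀ n, ‖a n‖ ≤ C) (hb : ∀ n, ‖b n‖ ≤ C) (hMb : ∀ n : ℕ, ‖((n : ℂ) + 1) * b n‖ ≤ C)
    (h : JacobiRel p (fun n => ((n : ℂ) + 1) * b n) fun n => (1 - (p : ℂ) ^ 2) * a n) (r : ℕ) :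
    (1 - (p : ℂ) ^ 2) * iteratedDeriv (r + 1) (genFun a) p
      = ((r : ℂ) + 1) * ((1 - (p : ℂ) ^ 2) * iteratedDeriv (r + 1) (genFun b) p
        - p * (r * iteratedDeriv (r - 1 + 1) (genFun b) p)) := by
  have hpb := ofReal_mem_ball hp
  have hban := (analyticOnNhd_genFun hb).deriv p hpb
  have hev : (fun z => (1 - (p : ℂ) ^ 2) * genFun a z) =ᶠ[nhds (p : ℂ)] fun z =>
      (z - p) * ((1 - (p : ℂ) ^ 2) * deriv (genFun b) z - p * ((z - p) * deriv (genFun b) z))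
        + p * b 0 := by
    filter_upwards [Metric.isOpen_ball.mem_nhds hpb] with z hz
    have h1 := h.hasSum hMb hz
    have h2 := (summable_genFun ha hz).hasSum.mul_left (1 - (p : ℂ) ^ 2)
    rw [(hasDerivAt_genFun hb hz).deriv]
    have h3 := h2.unique (h1.congr_eq (fun n => by ring) rfl)
    rw [genFun, h3]
    simp only [Nat.cast_zero, zero_add, one_mul]
    ring
  have h4 := hev.iteratedDeriv_eq (r + 1)
  have hsub : AnalyticAt ℂ (fun z : ℂ => (z - p) * deriv (genFun b) z) p := by fun_prop
  have hF1 : AnalyticAt ℂ (fun z : ℂ => (1 - (p : ℂ) ^ 2) * deriv (genFun b) z) p := by fun_prop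
  have hF2 : AnalyticAt ℂ (fun z : ℂ => p * ((z - p) * deriv (genFun b) z)) p := by fun_prop
  have hF : AnalyticAt ℂ (fun z : ℂ => (1 - (p : ℂ) ^ 2) * deriv (genFun b) z
      - p * ((z - p) * deriv (genFun b) z)) p := by fun_prop
  have hFF : AnalyticAt ℂ (fun z : ℂ => (z - p) * ((1 - (p : ℂ) ^ 2) * deriv (genFun b) z
      - p * ((z - p) * deriv (genFun b) z))) p := by fun_prop
  -- The order `r + 1` is positive, so the constant `p b₀` drops out.
  rw [iteratedDeriv_const_mul_field, iteratedDeriv_fun_add hFF.contDiffAt contDiffAt_const,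
    iteratedDeriv_sub_mul hF, iteratedDeriv_const, if_neg (by omega), add_zero,
    Nat.add_sub_cancel, iteratedDeriv_fun_sub hF1.contDiffAt hF2.contDiffAt, iteratedDeriv_const_mul_field,
    iteratedDeriv_const_mul_field, iteratedDeriv_sub_mul hban, ← iteratedDeriv_succ',
    ← iteratedDeriv_succ'] at h4
  rw [h4]; push_cast; ring

/-! ### Powers of the Möbius map -/

open PowerSeries in
/-- The power series of the Möbius map `(z - p) / (1 - p z)`. -/
def moebiusSeries (p : ℝ) : PowerSeries ℂ := (X - C (p : ℂ)) * mk fun n => (p : ℂ) ^ n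

open PowerSeries in
lemma mk_pow_mul_one_sub (p : ℂ) : (mk fun n => p ^ n) * (1 - C p * X) = 1 := by
  have h : (mk fun n => p ^ n) * (1 - C p * X)
      = (mk fun n => p ^ n) - C p * ((mk fun n => p ^ n) * X) := by ring
  rw [h]
  ext n
  rcases n with _ | n
  · simp
  · simp only [map_sub, coeff_mk, coeff_C_mul, coeff_succ_mul_X, coeff_one]
    rw [if_neg (by omega), pow_succ]; ring

open PowerSeries in
lemma moebiusSeries_ode (p : ℝ) :
    (X - C (p : ℂ)) * (1 - C (p : ℂ) * X) * d⁄dX ℂ (moebiusSeries p)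
      = C (1 - (p : ℂ) ^ 2) * moebiusSeries p := by
  set h : PowerSeries ℂ := mk fun n => (p : ℂ) ^ n with hh
  have h1 : h * (1 - C (p : ℂ) * X) = 1 := mk_pow_mul_one_sub _
  have h2 : d⁄dX ℂ h * (1 - C (p : ℂ) * X) = C (p : ℂ) * h := by
    have := congrArg (d⁄dX ℂ) h1
    simp only [Derivation.leibniz, map_sub, Derivation.map_one_eq_zero, derivative_X,
      derivative_C, smul_eq_mul, mul_zero, mul_one, add_zero, zero_sub] at this
    linear_combination this
  have h3 : d⁄dX ℂ (moebiusSeries p) = h + (X - C (p : ℂ)) * d⁄dX ℂ h := by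
    rw [moebiusSeries, ← hh]
    simp only [Derivation.leibniz, map_sub, derivative_X, derivative_C, smul_eq_mul]
    ring
  have h4 : C (1 - (p : ℂ) ^ 2) = 1 - C (p : ℂ) ^ 2 := by simp
  rw [h3, h4, moebiusSeries, ← hh]
  linear_combination (X - C (p : ℂ)) ^ 2 * h2

open PowerSeries in
-- Taking a power multiplies the logarithmic derivative by `m + 1`; this factor is the reciprocal of
-- the eigenvalue of `M⁻¹ T`.
lemma moebiusSeries_pow_ode (p : ℝ) (m : ℕ) :
    (X - C (p : ℂ)) * (1 - C (p : ℂ) * X) * d⁄dX ℂ (moebiusSeries p ^ (m + 1))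
      = C (((m : ℂ) + 1) * (1 - (p : ℂ) ^ 2)) * moebiusSeries p ^ (m + 1) := by
  rw [derivative_pow, Nat.add_sub_cancel, map_mul]
  have h : (C ((m : ℂ) + 1) : PowerSeries ℂ) = ((m + 1 : ℕ) : PowerSeries ℂ) := by
    simp
  rw [h]
  linear_combination (((m + 1 : ℕ) : PowerSeries ℂ) * moebiusSeries p ^ m) * moebiusSeries_ode p

/-- The coefficients of `(((z - p) / (1 - p z)) ^ (m + 1) - (-p) ^ (m + 1)) / z`. -/
def eigenSeq (p : ℝ) (m n : ℕ) : ℂ := PowerSeries.coeff (n + 1) (moebiusSeries p ^ (m + 1))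

open PowerSeries in
-- These are the coefficients of positive order in the differential equation for `w^(m+1)`. The
-- coefficient of order zero is discarded, which matches the removal of the constant term in
-- `eigenSeq`.
lemma jacobiRel_eigenSeq (p : ℝ) (m : ℕ) :
    JacobiRel p (fun n => ((n : ℂ) + 1) * eigenSeq p m n)
      fun n => ((m : ℂ) + 1) * (1 - (p : ℂ) ^ 2) * eigenSeq p m n := by
  set g := d⁄dX ℂ (moebiusSeries p ^ (m + 1)) with hg
  have hy : ∀ n : ℕ, ((n : ℂ) + 1) * eigenSeq p m n = coeff n g := fun n => by
    rw [hg, coeff_derivative, eigenSeq]; ring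
  have hode : C (1 + (p : ℂ) ^ 2) * (g * X) - C (p : ℂ) * g - C (p : ℂ) * (g * X * X)
      = C (((m : ℂ) + 1) * (1 - (p : ℂ) ^ 2)) * moebiusSeries p ^ (m + 1) := by
    rw [← moebiusSeries_pow_ode, ← hg]
    have h4 : C (1 + (p : ℂ) ^ 2) = 1 + C (p : ℂ) ^ 2 := by simp
    rw [h4]; ring
  rw [funext hy]
  refine ⟨?_, fun n => ?_⟩
  · have := congrArg (coeff (0 + 1)) hode
    simp only [map_sub, coeff_C_mul, coeff_succ_mul_X, coeff_zero_mul_X, mul_zero, sub_zero] at this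
    rw [zero_add] at this
    simpa only [eigenSeq, zero_add] using this
  · have := congrArg (coeff (n + 1 + 1)) hode
    simp only [map_sub, coeff_C_mul, coeff_succ_mul_X] at this
    simp only [eigenSeq]
    rw [← this]; ring

open PowerSeries in
-- The coefficient of order `n + 1` is only of size `p^n`, so the rate `p` itself fails for small
-- `p` (at `p = 0` the series is `X`). A rate of at least `1/2` absorbs the lost power into the
-- factor 2.
lemma norm_coeff_moebiusSeries_le {p r : ℝ} (hp : p ∈ Set.Ico (0 : ℝ) 1) (hpr : p ≤ r)
    (hr : 1 / 2 ≤ r) (n : ℕ) : ‖coeff n (moebiusSeries p)‖ ≤ 2 * r ^ n := by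
  have hr0 : 0 ≤ r := hp.1.trans hpr
  rw [moebiusSeries, sub_mul, map_sub, coeff_C_mul, mul_comm X]
  rcases n with _ | n
  · simp [abs_of_nonneg hp.1]; linarith [hp.2]
  · rw [coeff_succ_mul_X, coeff_mk, coeff_mk]
    have h1 : (p : ℂ) ^ n - p * (p : ℂ) ^ (n + 1) = ((p ^ n * (1 - p ^ 2) : ℝ) : ℂ) := by
      push_cast; ring
    have h2 : 0 ≤ p ^ n := pow_nonneg hp.1 n
    have h3 : p ^ n ≤ r ^ n := pow_le_pow_left₀ hp.1 hpr n
    have h4 : p ^ 2 < 1 := by nlinarith [hp.1, hp.2]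
    rw [h1, Complex.norm_real, Real.norm_of_nonneg (mul_nonneg h2 (by linarith)), pow_succ r]
    have h5 : p ^ n * (1 - p ^ 2) ≤ p ^ n * 1 :=
      mul_le_mul_of_nonneg_left (by nlinarith [sq_nonneg p]) h2
    have h6 : r ^ n * (1 / 2) ≤ r ^ n * r := mul_le_mul_of_nonneg_left hr (pow_nonneg hr0 n)
    linarith

open PowerSeries in
-- Each further Cauchy product has `n + 1` terms and costs one factor `n + 1`.
lemma norm_coeff_moebiusSeries_pow_le {p r : ℝ} (hp : p ∈ Set.Ico (0 : ℝ) 1) (hpr : p ≤ r)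
    (hr : 1 / 2 ≤ r) (m n : ℕ) :
    ‖coeff n (moebiusSeries p ^ (m + 1))‖ ≤ 2 ^ (m + 1) * ((n : ℝ) + 1) ^ m * r ^ n := by
  have hr0 : 0 ≤ r := hp.1.trans hpr
  induction m generalizing n with
  | zero => simpa using norm_coeff_moebiusSeries_le hp hpr hr n
  | succ m ih =>
    rw [pow_succ _ (m + 1), coeff_mul]
    have hterm : ∀ x ∈ Finset.HasAntidiagonal.antidiagonal n,
        ‖coeff x.1 (moebiusSeries p ^ (m + 1)) * coeff x.2 (moebiusSeries p)‖
          ≤ 2 ^ (m + 2) * ((n : ℝ) + 1) ^ m * r ^ n := fun x hx => by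
      rw [Finset.HasAntidiagonal.mem_antidiagonal] at hx
      have hx1 : (x.1 : ℝ) ≤ n := by exact_mod_cast (by omega : x.1 ≤ n)
      rw [norm_mul]
      calc _ ≤ (2 ^ (m + 1) * ((x.1 : ℝ) + 1) ^ m * r ^ x.1) * (2 * r ^ x.2) :=
            mul_le_mul (ih x.1) (norm_coeff_moebiusSeries_le hp hpr hr x.2) (norm_nonneg _)
              (by positivity)
        _ ≤ (2 ^ (m + 1) * ((n : ℝ) + 1) ^ m * r ^ x.1) * (2 * r ^ x.2) := by gcongr
        _ = _ := by rw [← hx, pow_add]; ring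
    refine (norm_sum_le_of_le _ hterm).trans (le_of_eq ?_)
    rw [Finset.sum_const, Finset.Nat.card_antidiagonal, nsmul_eq_mul]
    push_cast; ring

lemma summable_eigenSeq {p : ℝ} (hp : p ∈ Set.Ico (0 : ℝ) 1) (m : ℕ) :
    Summable fun n : ℕ => ((n : ℝ) + 1) ^ 2 * ‖eigenSeq p m n‖ ^ 2 := by
  set r := max p (1 / 2)
  have hr0 : 0 ≤ r := hp.1.trans (le_max_left _ _)
  have hr1 : r < 1 := max_lt hp.2 (by norm_num)
  have hr2 : r ^ 2 ∈ Set.Ico (0 : ℝ) 1 := ⟨sq_nonneg r, by nlinarith⟩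
  have h := ((summable_nat_add_iff 1).mpr (summable_weight (2 * m + 2) hr2)).mul_left
    ((2 ^ (m + 1)) ^ 2)
  refine Summable.of_nonneg_of_le (fun n => by positivity) (fun n => ?_) h
  have h1 := norm_coeff_moebiusSeries_pow_le hp (le_max_left p (1 / 2)) (le_max_right _ _) m (n + 1)
  calc ((n : ℝ) + 1) ^ 2 * ‖eigenSeq p m n‖ ^ 2
      ≤ (((n + 1 : ℕ) : ℝ) + 1) ^ 2 *
        (2 ^ (m + 1) * (((n + 1 : ℕ) : ℝ) + 1) ^ m * r ^ (n + 1)) ^ 2 := by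
        gcongr
        · linarith
        · exact h1
    _ = _ := by ring

/-- The eigenvector of `M⁻¹ T` for the eigenvalue `1 / (m + 1)`. -/
def eigenVec (p : Set.Ico (0 : ℝ) 1) (m : ℕ) : hOne :=
  ⟨⟨eigenSeq p m, (memℓp_iff_summable _).mpr (Summable.of_nonneg_of_le (fun n => by positivity)
    (fun n => le_mul_of_one_le_left (by positivity) (one_le_pow₀ (by simp)))
    (summable_eigenSeq p.2 m))⟩, summable_eigenSeq p.2 m⟩

@[simp] lemma eigenVec_apply (p : Set.Ico (0 : ℝ) 1) (m n : ℕ) :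
    (eigenVec p m).1 n = eigenSeq p m n := rfl

lemma eigenSeq_zero (p : ℝ) (n : ℕ) : eigenSeq p 0 n = (1 - (p : ℂ) ^ 2) * (p : ℂ) ^ n := by
  rw [eigenSeq, zero_add, pow_one, moebiusSeries, sub_mul, map_sub, PowerSeries.coeff_C_mul,
    mul_comm PowerSeries.X, PowerSeries.coeff_succ_mul_X, PowerSeries.coeff_mk,
    PowerSeries.coeff_mk]
  ring

open PowerSeries in
-- If all coefficients of positive order vanished, so would the derivative of `w^(m+1)`; the
-- differential equation would then force `w = 0`, yet `w` has linear coefficient `1 - p²`.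
lemma eigenVec_ne_zero (p : Set.Ico (0 : ℝ) 1) (m : ℕ) : eigenVec p m ≠ 0 := by
  intro h
  have hc : (1 - ((p : ℝ) : ℂ) ^ 2) ≠ 0 := by
    have : (1 - (p : ℝ) ^ 2) ≠ 0 := by nlinarith [p.2.1, p.2.2]
    exact_mod_cast this
  have h0 : d⁄dX ℂ (moebiusSeries p ^ (m + 1)) = 0 := by
    ext n
    have h1 : eigenSeq p m n = 0 := by rw [← eigenVec_apply, h]; simp
    rw [coeff_derivative, ← eigenSeq, h1]; simp
  have h2 := moebiusSeries_pow_ode p m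
  rw [h0, mul_zero] at h2
  have h3 : moebiusSeries p = 0 := by
    rcases mul_eq_zero.mp h2.symm with h4 | h4
    · rw [map_eq_zero_iff _ C_injective] at h4
      exact absurd h4 (mul_ne_zero (by exact_mod_cast m.succ_ne_zero) hc)
    · exact pow_eq_zero_iff (by omega) |>.mp h4
  have h5 : eigenSeq p 0 0 = 0 := by rw [eigenSeq, zero_add, pow_one, h3]; simp
  rw [eigenSeq_zero] at h5
  simp [hc] at h5

/-! ### Jets and the operator `M⁻¹ T` on `h¹` -/

lemma exists_bound (a : hOne) : ∃ C : ℝ, (∀ n, ‖a.1 n‖ ≤ C) ∧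
    ∀ n : ℕ, ‖((n : ℂ) + 1) * a.1 n‖ ≤ C := by
  obtain ⟨C, hC, h⟩ := exists_decay a
  refine ⟨C, fun n => (h n).trans (div_le_self hC (by simp)), fun n => ?_⟩
  have hn : ‖((n : ℂ) + 1)‖ = (n : ℝ) + 1 := by exact_mod_cast Complex.norm_natCast (n + 1)
  have := h n
  rw [le_div_iff₀ (by positivity)] at this
  rw [norm_mul, hn]; linarith

lemma one_sub_sq_ne_zero (p : Set.Ico (0 : ℝ) 1) : (1 - ((p : ℝ) : ℂ) ^ 2) ≠ 0 := by
  have : (1 - (p : ℝ) ^ 2) ≠ 0 := by nlinarith [p.2.1, p.2.2]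
  exact_mod_cast this

/-- The derivative of order `r + 1` at `p` of the generating function. -/
def jet (p : Set.Ico (0 : ℝ) 1) (r : ℕ) : hOne →ₗ[ℂ] ℂ where
  toFun a := iteratedDeriv (r + 1) (genFun a.1) (p : ℝ)
  map_add' a b := by
    obtain ⟨C, hC, -⟩ := exists_bound a
    obtain ⟨D, hD, -⟩ := exists_bound b
    have hp := ofReal_mem_ball p.2
    rw [← iteratedDeriv_add (analyticOnNhd_genFun hC _ hp).contDiffAt
      (analyticOnNhd_genFun hD _ hp).contDiffAt]
    refine Filter.EventuallyEq.iteratedDeriv_eq _ ?_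
    filter_upwards [Metric.isOpen_ball.mem_nhds hp] with z hz
    simp only [genFun, Pi.add_apply, Submodule.coe_add, lp.coeFn_add, add_mul]
    exact (summable_genFun hC hz).tsum_add (summable_genFun hD hz)
  map_smul' c a := by
    have h : genFun (c • a).1 = fun z => c * genFun a.1 z := by
      funext z
      simp only [genFun, Submodule.coe_smul, lp.coeFn_smul, Pi.smul_apply, smul_eq_mul, mul_assoc,
        tsum_mul_left]
    rw [h, iteratedDeriv_const_mul_field]; rfl

lemma eq_zero_of_jet {p : Set.Ico (0 : ℝ) 1} {a : hOne} (h : ∀ r, jet p r a = 0) : a = 0 := by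
  obtain ⟨C, hC, -⟩ := exists_bound a
  ext n
  exact eq_zero_of_iteratedDeriv_genFun hC (ofReal_mem_ball p.2) h n

/-- This identifies the functional in the rank-one part of `L_±` with the lowest jet. -/
lemma jet_zero_apply (p : Set.Ico (0 : ℝ) 1) (a : hOne) :
    jet p 0 a = ∑' j : ℕ, ((j : ℂ) + 1) * ((p : ℝ) : ℂ) ^ j * a.1 j := by
  obtain ⟨C, hC, -⟩ := exists_bound a
  change iteratedDeriv (0 + 1) (genFun a.1) (p : ℝ) = _
  rw [zero_add, iteratedDeriv_one, (hasDerivAt_genFun hC (ofReal_mem_ball p.2)).deriv]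
  exact tsum_congr fun n => by ring

lemma jet_of_jacobiRel {p : Set.Ico (0 : ℝ) 1} {a b : hOne}
    (h : JacobiRel p (fun n => ((n : ℂ) + 1) * b.1 n) fun n => (1 - ((p : ℝ) : ℂ) ^ 2) * a.1 n)
    (r : ℕ) : (1 - ((p : ℝ) : ℂ) ^ 2) * jet p r a
      = ((r : ℂ) + 1) * ((1 - ((p : ℝ) : ℂ) ^ 2) * jet p r b
        - (p : ℝ) * (r * jet p (r - 1) b)) := by
  obtain ⟨C, hC, -⟩ := exists_bound a
  obtain ⟨D, hD, hD'⟩ := exists_bound b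
  exact h.iteratedDeriv_genFun p.2 (fun n => (hC n).trans (le_max_left C D))
    (fun n => (hD n).trans (le_max_right C D)) (fun n => (hD' n).trans (le_max_right C D)) r

/-- The operator `M⁻¹ T` with `T` the matrix `greenKernel`. -/
def greenOp (p : Set.Ico (0 : ℝ) 1) : Module.End ℂ hOne :=
  -- The rank-one parts cancel in `L_+ + L_- = 4T - 2M`. Defining `M⁻¹ T` this way makes it a map of
  -- `h¹` without a new estimate.
  (1 / 4 : ℂ) • (M.symm.toLinearMap ∘ₗ L 1 p + M.symm.toLinearMap ∘ₗ L (-1) p)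
    + (1 / 2 : ℂ) • LinearMap.id

lemma M_symm_apply (x : Ell2) (n : ℕ) : (M.symm x).1 n = x n / ((n : ℂ) + 1) := rfl

lemma L_apply (σ : ℤˣ) (p : Set.Ico (0 : ℝ) 1) (a : hOne) (n : ℕ) :
    L σ p a n = 2 * (∑' k, (greenKernel p n k : ℂ) * a.1 k)
      + ((σ : ℤ) : ℂ) * ((1 - ((p : ℝ) : ℂ) ^ 2) ^ 2 * (((n : ℂ) + 1) * ((p : ℝ) : ℂ) ^ n *
          jet p 0 a)) - ((n : ℂ) + 1) * a.1 n := by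
  obtain ⟨C, hC, -⟩ := exists_bound a
  rw [jet_zero_apply, ← hessian_groundState σ p.2 hC n]
  rfl

lemma natCast_succ_ne_zero (n : ℕ) : ((n : ℂ) + 1) ≠ 0 := by exact_mod_cast n.succ_ne_zero

lemma greenOp_apply (p : Set.Ico (0 : ℝ) 1) (a : hOne) (n : ℕ) :
    (greenOp p a).1 n = (∑' k, (greenKernel p n k : ℂ) * a.1 k) / ((n : ℂ) + 1) := by
  have h : (greenOp p a).1 n = (1 / 4 : ℂ) * ((M.symm (L 1 p a)).1 n + (M.symm (L (-1) p a)).1 n)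
      + (1 / 2 : ℂ) * a.1 n := rfl
  have hn := natCast_succ_ne_zero n
  rw [h, M_symm_apply, M_symm_apply, L_apply, L_apply]
  push_cast
  field_simp
  ring

lemma M_symm_L (σ : ℤˣ) (p : Set.Ico (0 : ℝ) 1) (a : hOne) :
    M.symm (L σ p a) = (2 : ℂ) • greenOp p a - a
      + (((σ : ℤ) : ℂ) * ((1 - ((p : ℝ) : ℂ) ^ 2) * jet p 0 a)) • eigenVec p 0 := by
  ext n
  have hn := natCast_succ_ne_zero n
  change (M.symm (L σ p a)).1 n = (2 : ℂ) * (greenOp p a).1 n - a.1 n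
    + (((σ : ℤ) : ℂ) * ((1 - ((p : ℝ) : ℂ) ^ 2) * jet p 0 a)) * (eigenVec p 0).1 n
  rw [M_symm_apply, L_apply, greenOp_apply, eigenVec_apply, eigenSeq_zero]
  field_simp
  ring

lemma jacobiRel_greenOp (p : Set.Ico (0 : ℝ) 1) (a : hOne) :
    JacobiRel p (fun n => ((n : ℂ) + 1) * (greenOp p a).1 n)
      fun n => (1 - ((p : ℝ) : ℂ) ^ 2) * a.1 n := by
  obtain ⟨C, hC, -⟩ := exists_bound a
  have h : (fun n : ℕ => ((n : ℂ) + 1) * (greenOp p a).1 n)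
      = fun n => ∑' k, (greenKernel p n k : ℂ) * a.1 k := by
    funext n
    rw [greenOp_apply, mul_div_cancel₀ _ (natCast_succ_ne_zero n)]
  rw [h]
  exact ⟨greenSum_zero p.2 hC, greenSum_succ p.2 hC⟩

/-- The relation at order `r` involves only the jets of the image at orders `r` and `r - 1`, so
vanishing propagates upwards and the leading jet is scaled by `1/(r+1)`. -/
lemma jet_greenOp {p : Set.Ico (0 : ℝ) 1} {a : hOne} {r : ℕ} (h : ∀ s < r, jet p s a = 0) :
    (∀ s < r, jet p s (greenOp p a) = 0) ∧
      jet p r (greenOp p a) = jet p r a / ((r : ℂ) + 1) := by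
  have hc := one_sub_sq_ne_zero p
  have hrel := jet_of_jacobiRel (jacobiRel_greenOp p a)
  have key : ∀ r : ℕ, jet p (r - 1) (greenOp p a) = 0 ∨ r = 0 →
      jet p r (greenOp p a) = jet p r a / ((r : ℂ) + 1) := fun r hr => by
    have h1 := hrel r
    have h2 : (r : ℂ) * jet p (r - 1) (greenOp p a) = 0 := by
      rcases hr with hr | rfl
      · rw [hr, mul_zero]
      · simp
    rw [h2, mul_zero, sub_zero] at h1
    rw [eq_div_iff (natCast_succ_ne_zero r)]
    apply mul_left_cancel₀ hc
    rw [h1]; ring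
  have hlow : ∀ s < r, jet p s (greenOp p a) = 0 := by
    intro s
    induction s with
    | zero => intro hs; rw [key 0 (Or.inr rfl), h 0 hs, zero_div]
    | succ s ih => intro hs; rw [key (s + 1) (Or.inl (ih (by omega))), h _ hs, zero_div]
  refine ⟨hlow, key r ?_⟩
  rcases r with _ | r
  · exact Or.inr rfl
  · exact Or.inl (hlow r (by omega))

lemma jacobiRel_eigenVec (p : Set.Ico (0 : ℝ) 1) (m : ℕ) :
    JacobiRel p (fun n => ((n : ℂ) + 1) * (eigenVec p m).1 n)
      fun n => (1 - ((p : ℝ) : ℂ) ^ 2) * (((m : ℂ) + 1) • eigenVec p m).1 n := by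
  have h : (fun n => (1 - ((p : ℝ) : ℂ) ^ 2) * (((m : ℂ) + 1) • eigenVec p m).1 n)
      = fun n => ((m : ℂ) + 1) * (1 - ((p : ℝ) : ℂ) ^ 2) * eigenSeq p m n := by
    funext n
    change _ * (((m : ℂ) + 1) * eigenSeq p m n) = _
    ring
  rw [h]
  exact jacobiRel_eigenSeq p m

/-- Both `(m + 1) M⁻¹ T e_m` and `e_m` solve the same Jacobi relation. The jets of their difference
satisfy a homogeneous first-order recursion starting from zero, so all of them vanish. -/
lemma greenOp_eigenVec (p : Set.Ico (0 : ℝ) 1) (m : ℕ) :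
    greenOp p (eigenVec p m) = (1 / ((m : ℂ) + 1)) • eigenVec p m := by
  have hc := one_sub_sq_ne_zero p
  have hm := natCast_succ_ne_zero m
  set d := greenOp p (((m : ℂ) + 1) • eigenVec p m) - eigenVec p m with hd
  have h : ∀ r, jet p r d = 0 := by
    have hrel : ∀ r : ℕ, (1 - ((p : ℝ) : ℂ) ^ 2) * jet p r d
        = (p : ℝ) * (r * jet p (r - 1) d) := fun r => by
      have h1 := jet_of_jacobiRel (jacobiRel_greenOp p (((m : ℂ) + 1) • eigenVec p m)) r
      rw [jet_of_jacobiRel (jacobiRel_eigenVec p m) r] at h1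
      have h2 := mul_left_cancel₀ (natCast_succ_ne_zero r) h1
      rw [hd, map_sub, map_sub]
      linear_combination -h2
    intro r
    induction r with
    | zero =>
      have := hrel 0
      simpa [hc] using this
    | succ r ih =>
      have := hrel (r + 1)
      rw [Nat.add_sub_cancel, ih, mul_zero, mul_zero] at this
      exact (mul_eq_zero.mp this).resolve_left hc
  have h0 := sub_eq_zero.mp (eq_zero_of_jet h)
  rw [map_smul] at h0
  rw [← h0, smul_smul, one_div_mul_cancel hm, one_smul, h0]

/-- A first nonzero jet at order `r` would be scaled by both `1/(m+1)` and `1/(r+1)`, which forces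
`r = m`. -/
lemma jet_eigenVec_of_lt {p : Set.Ico (0 : ℝ) 1} {m r : ℕ} (h : r < m) :
    jet p r (eigenVec p m) = 0 := by
  induction r using Nat.strong_induction_on with
  | _ r ih =>
    have h1 := (jet_greenOp (p := p) (a := eigenVec p m) (r := r)
      fun s hs => ih s hs (hs.trans h)).2
    rw [greenOp_eigenVec, map_smul, smul_eq_mul, div_eq_mul_one_div, mul_comm] at h1
    by_contra hne
    have h2 := mul_left_cancel₀ hne h1
    rw [one_mul, one_div, inv_inj] at h2
    have h3 : m = r := by exact_mod_cast add_right_cancel h2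
    omega

lemma jet_eigenVec_self (p : Set.Ico (0 : ℝ) 1) (m : ℕ) : jet p m (eigenVec p m) ≠ 0 := by
  intro hm
  refine eigenVec_ne_zero p m (eq_zero_of_jet (p := p) fun r => ?_)
  induction r using Nat.strong_induction_on with
  | _ r ih =>
    by_contra hne
    have h1 := (jet_greenOp (p := p) (a := eigenVec p m) (r := r) ih).2
    rw [greenOp_eigenVec, map_smul, smul_eq_mul, div_eq_mul_one_div, mul_comm] at h1
    have h2 := mul_left_cancel₀ hne h1
    rw [one_mul, one_div, inv_inj] at h2
    have h3 : m = r := by exact_mod_cast add_right_cancel h2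
    exact hne (h3 ▸ hm)

/-- With this normalization the rank-one part adds exactly `±1` to the symbol at order zero. -/
lemma jet_zero_eigenVec_zero (p : Set.Ico (0 : ℝ) 1) :
    (1 - ((p : ℝ) : ℂ) ^ 2) * jet p 0 (eigenVec p 0) = 1 := by
  have hc := one_sub_sq_ne_zero p
  have hn : ‖((p : ℝ) : ℂ) ^ 2‖ < 1 := by
    rw [norm_pow, Complex.norm_real, Real.norm_of_nonneg p.2.1]
    nlinarith [p.2.1, p.2.2]
  have h := (hasSum_choose_mul_geometric_of_norm_lt_one 1 hn).mul_left (1 - ((p : ℝ) : ℂ) ^ 2)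
  rw [jet_zero_apply, (h.congr_eq (fun j => ?_) rfl).tsum_eq]
  · field_simp
  · rw [eigenVec_apply, eigenSeq_zero, Nat.choose_one_right, ← pow_mul]
    push_cast; ring

lemma linearization_apply (p : Set.Ico (0 : ℝ) 1) (a b : hOne) :
    linearization p (a, b) =
      (-((2 : ℂ) • greenOp p b - b + ((1 - ((p : ℝ) : ℂ) ^ 2) * jet p 0 b) • eigenVec p 0),
        (2 : ℂ) • greenOp p a - a - ((1 - ((p : ℝ) : ℂ) ^ 2) * jet p 0 a) • eigenVec p 0) := by
  have h : linearization p (a, b) = (-(M.symm (L 1 p b)), M.symm (L (-1) p a)) := rfl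
  rw [h, M_symm_L, M_symm_L]
  simp [sub_eq_add_neg]

/-! ### The linearization on leading jets -/

/-- The jets of both components vanish to order `r`. -/
def JetVanish (p : Set.Ico (0 : ℝ) 1) (r : ℕ) (x : hOne × hOne) : Prop :=
  ∀ s < r, jet p s x.1 = 0 ∧ jet p s x.2 = 0

lemma Omega_zero : Omega 0 = 0 := by simp [Omega]

lemma Omega_one : Omega 1 = 0 := by simp [Omega]

lemma Omega_of_one_le {m : ℕ} (hm : 1 ≤ m) : Omega m = ((m : ℝ) - 1) / ((m : ℝ) + 1) := by
  rcases hm.lt_or_eq with h | rfl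
  · rw [Omega, if_neg (by omega)]
  · simp [Omega]

lemma Omega_pos {m : ℕ} (hm : 2 ≤ m) : 0 < Omega m := by
  have : (2 : ℝ) ≤ m := by exact_mod_cast hm
  rw [Omega_of_one_le (by omega)]
  exact div_pos (by linarith) (by linarith)

lemma Omega_nonneg (m : ℕ) : 0 ≤ Omega m := by
  rcases le_or_gt 2 m with h | h
  · exact (Omega_pos h).le
  · rw [Omega, if_pos (by omega)]

lemma Omega_inj {m r : ℕ} (hm : 2 ≤ m) (h : Omega r = Omega m) : r = m := by
  have hr : 1 ≤ r := by
    by_contra hr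
    have := Omega_pos hm
    rw [← h, show r = 0 by omega, Omega_zero] at this
    exact lt_irrefl _ this
  rw [Omega_of_one_le hr, Omega_of_one_le (by omega : 1 ≤ m),
    div_eq_div_iff (by positivity) (by positivity)] at h
  have : (r : ℝ) = m := by linarith
  exact_mod_cast this

lemma neg_Omega_sq_inj {m r : ℕ} (hm : 2 ≤ m)
    (h : -(Omega m : ℂ) ^ 2 = -(Omega r : ℂ) ^ 2) : r = m := by
  have h1 : Omega r ^ 2 = Omega m ^ 2 := by exact_mod_cast (neg_inj.mp h).symm
  exact Omega_inj hm ((sq_eq_sq₀ (Omega_nonneg r) (Omega_nonneg m)).mp h1)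

/-- The action of `M⁻¹ L_±` on the leading jet of order `r`, with `±` given by `ε`. -/
def jetSymbol (ε : ℂ) (r : ℕ) : ℂ := 2 / ((r : ℂ) + 1) - 1 + if r = 0 then ε else 0

/-- At order zero the symbols are `2` and `0`; at every order `r ≥ 1` both equal `-Ω_r`. -/
lemma jetSymbol_mul (r : ℕ) : jetSymbol 1 r * jetSymbol (-1) r = (Omega r : ℂ) ^ 2 := by
  rcases r with _ | r
  · simp [jetSymbol, Omega_zero]; norm_num
  · have h : ((r : ℂ) + 1 + 1) ≠ 0 := by exact_mod_cast (r + 1).succ_ne_zero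
    rw [Omega_of_one_le (by omega), jetSymbol, jetSymbol, if_neg (by omega), if_neg (by omega)]
    push_cast
    field_simp
    ring

lemma jet_leading {p : Set.Ico (0 : ℝ) 1} {r : ℕ} {a : hOne} (h : ∀ s < r, jet p s a = 0)
    (ε : ℂ) :
    (∀ s < r, jet p s ((2 : ℂ) • greenOp p a - a
      + (ε * ((1 - ((p : ℝ) : ℂ) ^ 2) * jet p 0 a)) • eigenVec p 0) = 0) ∧
    jet p r ((2 : ℂ) • greenOp p a - a
      + (ε * ((1 - ((p : ℝ) : ℂ) ^ 2) * jet p 0 a)) • eigenVec p 0)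
      = jetSymbol ε r * jet p r a := by
  obtain ⟨h1, h2⟩ := jet_greenOp h
  simp only [map_add, map_sub, map_smul, smul_eq_mul]
  refine ⟨fun s hs => ?_, ?_⟩
  · rw [h1 s hs, h s hs, h 0 (by omega)]; simp
  · rw [h2, jetSymbol]
    rcases r with _ | r
    · rw [if_pos rfl]
      linear_combination ε * jet p 0 a * jet_zero_eigenVec_zero p
    · rw [if_neg (by omega), h 0 (by omega)]; ring

lemma JetVanish.linearization {p : Set.Ico (0 : ℝ) 1} {r : ℕ} {x : hOne × hOne}
    (h : JetVanish p r x) : JetVanish p r (linearization p x) ∧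
      jet p r (ConformalFlow.linearization p x).1 = -(jetSymbol 1 r * jet p r x.2) ∧
      jet p r (ConformalFlow.linearization p x).2 = jetSymbol (-1) r * jet p r x.1 := by
  obtain ⟨a, b⟩ := x
  obtain ⟨h1, h2⟩ := jet_leading (fun s hs => (h s hs).1) (-1)
  obtain ⟨h3, h4⟩ := jet_leading (fun s hs => (h s hs).2) 1
  simp only [neg_one_mul, neg_smul, one_mul, ← sub_eq_add_neg] at h1 h2 h3 h4
  rw [linearization_apply]
  refine ⟨fun s hs => ⟨?_, h1 s hs⟩, ?_, h2⟩
  · rw [map_neg, h3 s hs, neg_zero]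
  · rw [map_neg, h4]

/-- The linearization exchanges the two components, but its square acts on the leading jet of each
by the same scalar, which is why the argument runs with the square. -/
lemma JetVanish.linearization_sq {p : Set.Ico (0 : ℝ) 1} {r : ℕ} {x : hOne × hOne}
    (h : JetVanish p r x) (μ : ℂ) :
    JetVanish p r ((ConformalFlow.linearization p * ConformalFlow.linearization p
      - μ • (1 : Module.End ℂ (hOne × hOne))) x) ∧
    jet p r ((ConformalFlow.linearization p * ConformalFlow.linearization p
      - μ • (1 : Module.End ℂ (hOne × hOne))) x).1 = (-(Omega r : ℂ) ^ 2 - μ) * jet p r x.1 ∧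
    jet p r ((ConformalFlow.linearization p * ConformalFlow.linearization p
      - μ • (1 : Module.End ℂ (hOne × hOne))) x).2 = (-(Omega r : ℂ) ^ 2 - μ) * jet p r x.2 := by
  obtain ⟨h1, h2, h3⟩ := h.linearization
  obtain ⟨h4, h5, h6⟩ := h1.linearization
  have hmul := jetSymbol_mul r
  have e : (ConformalFlow.linearization p * ConformalFlow.linearization p
      - μ • (1 : Module.End ℂ (hOne × hOne))) x
      = ConformalFlow.linearization p (ConformalFlow.linearization p x) - μ • x := rfl
  rw [e]
  simp only [JetVanish, Prod.fst_sub, Prod.snd_sub, Prod.smul_fst, Prod.smul_snd, map_sub,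
    map_smul, smul_eq_mul]
  refine ⟨fun s hs => ?_, ?_, ?_⟩
  · rw [(h4 s hs).1, (h4 s hs).2, (h s hs).1, (h s hs).2]; simp
  · rw [h5, h3]; linear_combination -jet p r x.1 * hmul
  · rw [h6, h2]; linear_combination -jet p r x.2 * hmul

lemma JetVanish.linearization_sq_pow {p : Set.Ico (0 : ℝ) 1} {r : ℕ} {x : hOne × hOne}
    (h : JetVanish p r x) (μ : ℂ) (k : ℕ) :
    JetVanish p r (((ConformalFlow.linearization p * ConformalFlow.linearization p
      - μ • (1 : Module.End ℂ (hOne × hOne))) ^ k) x) ∧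
    jet p r (((ConformalFlow.linearization p * ConformalFlow.linearization p
      - μ • (1 : Module.End ℂ (hOne × hOne))) ^ k) x).1
        = (-(Omega r : ℂ) ^ 2 - μ) ^ k * jet p r x.1 ∧
    jet p r (((ConformalFlow.linearization p * ConformalFlow.linearization p
      - μ • (1 : Module.End ℂ (hOne × hOne))) ^ k) x).2
        = (-(Omega r : ℂ) ^ 2 - μ) ^ k * jet p r x.2 := by
  induction k with
  | zero => simpa using h
  | succ k ih =>
    obtain ⟨h1, h2, h3⟩ := ih
    obtain ⟨h4, h5, h6⟩ := h1.linearization_sq μ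
    rw [pow_succ', Module.End.mul_apply]
    refine ⟨h4, ?_, ?_⟩
    · rw [h5, h2]; ring
    · rw [h6, h3]; ring

/-! ### Generalized eigenspaces of the square -/

/-- The generalized eigenspaces of the square of the linearization. -/
abbrev sqGenEigenspace (p : Set.Ico (0 : ℝ) 1) (μ : ℂ) : Submodule ℂ (hOne × hOne) :=
  (linearization p * linearization p).maxGenEigenspace μ

lemma JetVanish.succ {p : Set.Ico (0 : ℝ) 1} {r : ℕ} {x : hOne × hOne} (h : JetVanish p r x)
    (h1 : jet p r x.1 = 0) (h2 : jet p r x.2 = 0) : JetVanish p (r + 1) x := fun s hs => by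
  rcases (Nat.lt_succ_iff.mp hs).lt_or_eq with h3 | rfl
  · exact h s h3
  · exact ⟨h1, h2⟩

/-- Some power of the shifted square kills `x` while multiplying its leading jet by a nonzero
number. -/
lemma JetVanish.succ_of_mem {p : Set.Ico (0 : ℝ) 1} {r : ℕ} {x : hOne × hOne}
    (h : JetVanish p r x) {μ : ℂ} (hx : x ∈ sqGenEigenspace p μ)
    (hμ : μ ≠ -(Omega r : ℂ) ^ 2) : JetVanish p (r + 1) x := by
  obtain ⟨k, hk⟩ := (Module.End.mem_maxGenEigenspace _ _ _).mp hx
  obtain ⟨-, h1, h2⟩ := h.linearization_sq_pow μ k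
  have hne : (-(Omega r : ℂ) ^ 2 - μ) ^ k ≠ 0 := pow_ne_zero _ (sub_ne_zero.mpr hμ.symm)
  rw [hk] at h1 h2
  simp only [Prod.fst_zero, Prod.snd_zero, map_zero] at h1 h2
  exact h.succ ((mul_eq_zero.mp h1.symm).resolve_left hne)
    ((mul_eq_zero.mp h2.symm).resolve_left hne)

lemma JetVanish.zero (p : Set.Ico (0 : ℝ) 1) (x : hOne × hOne) : JetVanish p 0 x :=
  fun s hs => absurd hs (Nat.not_lt_zero s)

lemma JetVanish.of_mem {p : Set.Ico (0 : ℝ) 1} {r : ℕ} {x : hOne × hOne}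
    (h : JetVanish p r x) {μ : ℂ} (hx : x ∈ sqGenEigenspace p μ) {d : ℕ}
    (hμ : ∀ s, r ≤ s → s < r + d → μ ≠ -(Omega s : ℂ) ^ 2) : JetVanish p (r + d) x := by
  induction d with
  | zero => exact h
  | succ d ih =>
    exact (ih fun s h1 h2 => hμ s h1 (by omega)).succ_of_mem hx (hμ _ (by omega) (by omega))

lemma JetVanish.eq_zero {p : Set.Ico (0 : ℝ) 1} {r : ℕ} {x : hOne × hOne}
    (h : JetVanish p r x) {μ : ℂ} (hx : x ∈ sqGenEigenspace p μ)
    (hμ : ∀ s, r ≤ s → μ ≠ -(Omega s : ℂ) ^ 2) : x = 0 := by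
  have hall : ∀ s, jet p s x.1 = 0 ∧ jet p s x.2 = 0 := fun s =>
    h.of_mem hx (d := s + 1) (fun t h1 _ => hμ t h1) s (by omega)
  exact Prod.ext (eq_zero_of_jet fun s => (hall s).1) (eq_zero_of_jet fun s => (hall s).2)

/-- For `m ≥ 1` the lowest jet of `e_m` vanishes, so the rank-one part is not felt. -/
lemma linearization_smul_eigenVec {p : Set.Ico (0 : ℝ) 1} {m : ℕ} (hm : 1 ≤ m) (x y : ℂ) :
    linearization p (x • eigenVec p m, y • eigenVec p m)
      = (((Omega m : ℂ) * y) • eigenVec p m, (-((Omega m : ℂ) * x)) • eigenVec p m) := by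
  have hm' := natCast_succ_ne_zero m
  rw [linearization_apply, map_smul, map_smul, map_smul, map_smul, jet_eigenVec_of_lt hm,
    greenOp_eigenVec, Omega_of_one_le hm]
  simp only [smul_zero, mul_zero, zero_smul, add_zero, sub_zero, smul_smul, ← sub_smul, ← neg_smul]
  push_cast
  congr 2
  · field_simp; ring
  · field_simp; ring

/-- Here the rank-one part counts: `M⁻¹ L_-` kills the ground state and `M⁻¹ L_+` doubles it, the
source of the block of size two. -/
lemma linearization_smul_eigenVec_zero (p : Set.Ico (0 : ℝ) 1) (x y : ℂ) :
    linearization p (x • eigenVec p 0, y • eigenVec p 0) = ((-2 * y) • eigenVec p 0, 0) := by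
  have h := jet_zero_eigenVec_zero p
  have h' : ∀ x, (1 - ((p : ℝ) : ℂ) ^ 2) * (x * jet p 0 (eigenVec p 0)) = x := fun x => by
    linear_combination x * h
  rw [linearization_apply, map_smul, map_smul, map_smul, map_smul, greenOp_eigenVec]
  simp only [smul_eq_mul, h', smul_smul, ← sub_smul, ← add_smul, ← neg_smul]
  congr 2
  · push_cast; ring
  · rw [show (2 : ℂ) * (x * (1 / (((0 : ℕ) : ℂ) + 1))) - x - x = 0 by push_cast; ring, zero_smul]

lemma smul_eigenVec_mem_sqGenEigenspace {p : Set.Ico (0 : ℝ) 1} {m : ℕ} (x y : ℂ) :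
    (x • eigenVec p m, y • eigenVec p m) ∈ sqGenEigenspace p (-(Omega m : ℂ) ^ 2) := by
  rw [Module.End.mem_maxGenEigenspace]
  refine ⟨1, ?_⟩
  rw [pow_one]
  change linearization p (linearization p (x • eigenVec p m, y • eigenVec p m))
    - (-(Omega m : ℂ) ^ 2) • (x • eigenVec p m, y • eigenVec p m) = 0
  rcases m with _ | m
  · have := linearization_smul_eigenVec_zero p (-2 * y) 0
    rw [zero_smul] at this
    rw [linearization_smul_eigenVec_zero, this, Omega_zero]
    simp
  · rw [linearization_smul_eigenVec (by omega), linearization_smul_eigenVec (by omega)]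
    rw [sub_eq_zero, Prod.smul_mk, smul_smul, smul_smul]
    congr 2 <;> ring

/-- Subtracting a multiple of the `m`-th eigenvector raises the order of vanishing. -/
lemma JetVanish.exists_sub {p : Set.Ico (0 : ℝ) 1} {m : ℕ} {x : hOne × hOne}
    (h : JetVanish p m x) : ∃ s t : ℂ,
      JetVanish p (m + 1) (x - (s • eigenVec p m, t • eigenVec p m)) := by
  have hne := jet_eigenVec_self p m
  refine ⟨jet p m x.1 / jet p m (eigenVec p m), jet p m x.2 / jet p m (eigenVec p m), ?_⟩
  refine JetVanish.succ (fun r hr => ?_) ?_ ?_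
  · simp [(h r hr).1, (h r hr).2, jet_eigenVec_of_lt hr]
  · simp [hne]
  · simp [hne]

/-- Only order `m` is resonant, so one subtraction leaves a vector with no admissible leading jet.
-/
lemma exists_of_mem_sqGenEigenspace {p : Set.Ico (0 : ℝ) 1} {m : ℕ} (hm : 2 ≤ m)
    {x : hOne × hOne} (hx : x ∈ sqGenEigenspace p (-(Omega m : ℂ) ^ 2)) :
    ∃ s t : ℂ, x = (s • eigenVec p m, t • eigenVec p m) := by
  have h1 : JetVanish p m x := by
    have := (JetVanish.zero p x).of_mem hx (d := m) fun s _ h2 h3 => by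
      have := neg_Omega_sq_inj hm h3
      omega
    rwa [zero_add] at this
  obtain ⟨s, t, h2⟩ := h1.exists_sub
  refine ⟨s, t, sub_eq_zero.mp (h2.eq_zero
    (Submodule.sub_mem _ hx (smul_eigenVec_mem_sqGenEigenspace s t)) fun r h3 h4 => ?_)⟩
  have := neg_Omega_sq_inj hm h4
  omega

/-- Orders 0 and 1 are both resonant, since `Ω₀ = Ω₁ = 0`; hence two subtractions. -/
lemma exists_of_mem_sqGenEigenspace_zero {p : Set.Ico (0 : ℝ) 1}
    {x : hOne × hOne} (hx : x ∈ sqGenEigenspace p 0) :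
    ∃ s t s' t' : ℂ, x = (s • eigenVec p 0 + s' • eigenVec p 1,
      t • eigenVec p 0 + t' • eigenVec p 1) := by
  obtain ⟨s, t, h1⟩ := (JetVanish.zero p x).exists_sub
  obtain ⟨s', t', h2⟩ := h1.exists_sub
  have hmem : ∀ m, m ≤ 1 → ∀ x y : ℂ, (x • eigenVec p m, y • eigenVec p m)
      ∈ sqGenEigenspace p 0 := fun m hm x y => by
    have := smul_eigenVec_mem_sqGenEigenspace (p := p) (m := m) x y
    have h0 : Omega m = 0 := by rw [Omega, if_pos hm]
    rw [h0] at this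
    simpa using this
  refine ⟨s, t, s', t', ?_⟩
  have h3 := h2.eq_zero (Submodule.sub_mem _ (Submodule.sub_mem _ hx (hmem 0 (by omega) s t))
    (hmem 1 le_rfl s' t')) fun r h4 h5 => ?_
  · rw [sub_sub, sub_eq_zero] at h3
    exact h3
  · have := Omega_pos h4
    have h6 : (Omega r : ℂ) ^ 2 = 0 := neg_eq_zero.mp h5.symm
    have h7 : Omega r = 0 := by exact_mod_cast pow_eq_zero_iff (two_ne_zero) |>.mp h6
    exact this.ne' h7

/-- `J² - Λ² = (J + Λ)(J - Λ)` with commuting factors. -/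
lemma maxGenEigenspace_le_sqGenEigenspace (p : Set.Ico (0 : ℝ) 1) (Λ : ℂ) :
    (linearization p).maxGenEigenspace Λ ≤ sqGenEigenspace p (Λ ^ 2) := by
  intro x hx
  obtain ⟨k, hk⟩ := (Module.End.mem_maxGenEigenspace _ _ _).mp hx
  rw [Module.End.mem_maxGenEigenspace]
  refine ⟨k, ?_⟩
  set J := linearization p
  have h1 : J * J - Λ ^ 2 • (1 : Module.End ℂ (hOne × hOne)) = (J + Λ • 1) * (J - Λ • 1) := by
    rw [add_mul, mul_sub, mul_sub, mul_smul_comm, smul_mul_assoc, smul_mul_assoc, mul_one, one_mul,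
      mul_smul_comm, one_mul, smul_smul, ← pow_two Λ]
    abel
  have h2 : Commute (J + Λ • (1 : Module.End ℂ (hOne × hOne))) (J - Λ • 1) := by
    have h3 : Commute J (Λ • (1 : Module.End ℂ (hOne × hOne))) :=
      (Commute.one_right J).smul_right Λ
    exact ((Commute.refl J).add_left h3.symm).sub_right (h3.add_left (Commute.refl _))
  rw [h1, h2.mul_pow, Module.End.mul_apply, hk, map_zero]

lemma eq_zero_of_smul_add_smul {p : Set.Ico (0 : ℝ) 1} {x y : ℂ}
    (h : x • eigenVec p 0 + y • eigenVec p 1 = 0) : x = 0 ∧ y = 0 := by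
  have h0 := congrArg (jet p 0) h
  rw [map_add, map_smul, map_smul, jet_eigenVec_of_lt one_pos, smul_zero, add_zero, map_zero,
    smul_eq_mul] at h0
  have hx := (mul_eq_zero.mp h0).resolve_right (jet_eigenVec_self p 0)
  rw [hx, zero_smul, zero_add] at h
  exact ⟨hx, (smul_eq_zero.mp h).resolve_right (eigenVec_ne_zero p 1)⟩

/-! ### Jordan structure at the eigenvalue zero -/

/-- A Jordan basis of the generalized kernel of the linearization. -/
def kerVec (p : Set.Ico (0 : ℝ) 1) : Fin 4 → hOne × hOne :=
  -- The factor `-1/2` cancels the `-2` in `linearization_smul_eigenVec_zero`, so that the second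
  -- vector maps exactly to the first.
  ![(eigenVec p 0, 0), (0, (-(1 / 2) : ℂ) • eigenVec p 0), (eigenVec p 1, 0), (0, eigenVec p 1)]

lemma linearization_kerVec (p : Set.Ico (0 : ℝ) 1) :
    linearization p (kerVec p 0) = 0 ∧ linearization p (kerVec p 1) = kerVec p 0 ∧
      linearization p (kerVec p 2) = 0 ∧ linearization p (kerVec p 3) = 0 := by
  have h0 := linearization_smul_eigenVec_zero p
  have h1 := linearization_smul_eigenVec (p := p) (m := 1) le_rfl
  rw [Omega_one] at h1
  refine ⟨?_, ?_, ?_, ?_⟩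
  · simpa [kerVec, ← Prod.zero_eq_mk] using h0 1 0
  · simpa [kerVec] using h0 0 (-(1 / 2))
  · simpa [kerVec, ← Prod.zero_eq_mk] using h1 1 0
  · simpa [kerVec, ← Prod.zero_eq_mk] using h1 0 1

lemma sum_smul_kerVec (p : Set.Ico (0 : ℝ) 1) (g : Fin 4 → ℂ) :
    ∑ i, g i • kerVec p i = (g 0 • eigenVec p 0 + g 2 • eigenVec p 1,
      (-(1 / 2) * g 1) • eigenVec p 0 + g 3 • eigenVec p 1) := by
  rw [Fin.sum_univ_four]
  simp [kerVec, smul_smul, mul_comm]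

lemma linearIndependent_kerVec (p : Set.Ico (0 : ℝ) 1) : LinearIndependent ℂ (kerVec p) := by
  rw [Fintype.linearIndependent_iff]
  intro g hg
  rw [sum_smul_kerVec, Prod.mk_eq_zero] at hg
  obtain ⟨h0, h2⟩ := eq_zero_of_smul_add_smul hg.1
  obtain ⟨h1, h3⟩ := eq_zero_of_smul_add_smul hg.2
  have h1' : g 1 = 0 := by simpa using h1
  intro i
  fin_cases i
  exacts [h0, h1', h2, h3]

lemma span_kerVec (p : Set.Ico (0 : ℝ) 1) :
    Submodule.span ℂ (Set.range (kerVec p)) = (linearization p).maxGenEigenspace 0 := by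
  obtain ⟨h0, h1, h2, h3⟩ := linearization_kerVec p
  refine le_antisymm (Submodule.span_le.mpr ?_) fun x hx => ?_
  · rintro _ ⟨i, rfl⟩
    rw [SetLike.mem_coe, Module.End.mem_maxGenEigenspace]
    refine ⟨2, ?_⟩
    rw [zero_smul, sub_zero, pow_two, Module.End.mul_apply]
    fin_cases i
    · change linearization p (linearization p (kerVec p 0)) = 0
      rw [h0, map_zero]
    · change linearization p (linearization p (kerVec p 1)) = 0
      rw [h1, h0]
    · change linearization p (linearization p (kerVec p 2)) = 0
      rw [h2, map_zero]
    · change linearization p (linearization p (kerVec p 3)) = 0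
      rw [h3, map_zero]
  · have hx' := maxGenEigenspace_le_sqGenEigenspace p 0 hx
    rw [zero_pow two_ne_zero] at hx'
    obtain ⟨s, t, s', t', rfl⟩ := exists_of_mem_sqGenEigenspace_zero hx'
    rw [Submodule.mem_span_range_iff_exists_fun]
    refine ⟨![s, -2 * t, s', t'], ?_⟩
    rw [sum_smul_kerVec]
    simp

/-- The Jordan basis of the generalized kernel. -/
def kerBasis (p : Set.Ico (0 : ℝ) 1) :
    Module.Basis (Fin 4) ℂ ((linearization p).maxGenEigenspace 0) :=
  (Module.Basis.span (linearIndependent_kerVec p)).map (LinearEquiv.ofEq _ _ (span_kerVec p))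

lemma kerBasis_apply (p : Set.Ico (0 : ℝ) 1) (i : Fin 4) :
    (kerBasis p i : hOne × hOne) = kerVec p i := by
  simp [kerBasis, Module.Basis.span_apply]

lemma span_kerVec_comp (p : Set.Ico (0 : ℝ) 1) :
    Submodule.span ℂ (Set.range (kerVec p ∘ (Fin.succAbove 1))) =
      (linearization p).eigenspace 0 := by
  obtain ⟨h0, h1, h2, h3⟩ := linearization_kerVec p
  refine le_antisymm (Submodule.span_le.mpr ?_) fun x hx => ?_
  · rintro _ ⟨i, rfl⟩
    rw [SetLike.mem_coe, Module.End.mem_eigenspace_iff, zero_smul]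
    fin_cases i
    exacts [h0, h2, h3]
  · have hx0 : linearization p x = 0 := by
      rw [Module.End.mem_eigenspace_iff, zero_smul] at hx
      exact hx
    have hmem : x ∈ Submodule.span ℂ (Set.range (kerVec p)) := by
      rw [span_kerVec]
      exact (linearization p).genEigenspace 0 |>.monotone le_top hx
    obtain ⟨g, rfl⟩ := (Submodule.mem_span_range_iff_exists_fun ℂ).mp hmem
    have hg : g 1 = 0 := by
      rw [map_sum, Fin.sum_univ_four] at hx0
      simp only [map_smul, h0, h1, h2, h3, smul_zero, zero_add, add_zero] at hx0
      exact (smul_eq_zero.mp hx0).resolve_right ((linearIndependent_kerVec p).ne_zero 0)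
    rw [Submodule.mem_span_range_iff_exists_fun]
    -- `Fin.succAbove 1` omits index 1, the only basis vector outside the kernel.
    refine ⟨g ∘ Fin.succAbove 1, ?_⟩
    rw [Fin.sum_univ_succAbove (fun i => g i • kerVec p i) 1, hg, zero_smul, zero_add]
    rfl

lemma finrank_eigenspace_zero (p : Set.Ico (0 : ℝ) 1) :
    Module.finrank ℂ ((linearization p).eigenspace 0) = 3 := by
  rw [← span_kerVec_comp, finrank_span_eq_card
    ((linearIndependent_kerVec p).comp _ Fin.succAbove_right_injective), Fintype.card_fin]

/-! ### Simplicity of the nonzero eigenvalues and the full spectrum -/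

/-- The eigenvector of the linearization for the eigenvalue `ε Ω_m`, where `ε² = -1`. -/
def linEigenVec (p : Set.Ico (0 : ℝ) 1) (m : ℕ) (ε : ℂ) : hOne × hOne :=
  (eigenVec p m, ε • eigenVec p m)

lemma linEigenVec_ne_zero (p : Set.Ico (0 : ℝ) 1) (m : ℕ) (ε : ℂ) : linEigenVec p m ε ≠ 0 :=
  fun h => eigenVec_ne_zero p m (congrArg Prod.fst h)

lemma linearization_linEigenVec {p : Set.Ico (0 : ℝ) 1} {m : ℕ} (hm : 1 ≤ m) {ε : ℂ}
    (hε : ε ^ 2 = -1) :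
    linearization p (linEigenVec p m ε) = (ε * Omega m) • linEigenVec p m ε := by
  have h := linearization_smul_eigenVec (p := p) hm 1 ε
  rw [one_smul] at h
  rw [linEigenVec, h, Prod.smul_mk, smul_smul]
  congr 2
  · ring
  · linear_combination -(Omega m : ℂ) * hε

/-- The generalized eigenspace lies in a plane spanned by eigenvectors for `±ε Ω_m`. The component
along the opposite eigenvalue lies in two disjoint generalized eigenspaces, hence vanishes. -/
lemma maxGenEigenspace_eq_span {p : Set.Ico (0 : ℝ) 1} {m : ℕ} (hm : 2 ≤ m) {ε : ℂ}
    (hε : ε ^ 2 = -1) :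
    (linearization p).maxGenEigenspace (ε * Omega m) = ℂ ∙ linEigenVec p m ε := by
  have hε0 : ε ≠ 0 := by rintro rfl; norm_num at hε
  have hΩ : (Omega m : ℂ) ≠ 0 := by exact_mod_cast (Omega_pos hm).ne'
  have hmem : ∀ {δ : ℂ}, δ ^ 2 = -1 → linEigenVec p m δ ∈
      (linearization p).maxGenEigenspace (δ * Omega m) := fun {δ} hδ =>
    (linearization p).genEigenspace (δ * Omega m) |>.monotone le_top
      (Module.End.mem_eigenspace_iff.mpr (linearization_linEigenVec (by omega) hδ))
  refine le_antisymm (fun x hx => ?_) ?_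
  · have hx' := maxGenEigenspace_le_sqGenEigenspace p _ hx
    rw [mul_pow, hε, neg_one_mul] at hx'
    obtain ⟨s, t, rfl⟩ := exists_of_mem_sqGenEigenspace hm hx'
    set k := ε * s - t with hk
    have h1 : (s • eigenVec p m, t • eigenVec p m)
        = (s - k / (2 * ε)) • linEigenVec p m ε + (k / (2 * ε)) • linEigenVec p m (-ε) := by
      simp only [linEigenVec, Prod.smul_mk, Prod.mk_add_mk, smul_smul, ← add_smul]
      congr 2
      · ring
      · rw [hk]; field_simp; ring
    have h2 : (k / (2 * ε)) • linEigenVec p m (-ε) ∈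
        (linearization p).maxGenEigenspace (ε * Omega m) := by
      rw [h1] at hx
      exact (Submodule.add_mem_iff_right _ (Submodule.smul_mem _ _ (hmem hε))).mp hx
    have h3 := Submodule.smul_mem _ (k / (2 * ε)) (hmem (δ := -ε) (by rw [neg_sq, hε]))
    have hne : ε * (Omega m : ℂ) ≠ -ε * Omega m := fun h => by
      have : 2 * (ε * (Omega m : ℂ)) = 0 := by linear_combination h
      exact mul_ne_zero two_ne_zero (mul_ne_zero hε0 hΩ) this
    have h4 := Submodule.disjoint_def.mp
      ((linearization p).disjoint_genEigenspace hne ⊤ ⊤) _ h2 h3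
    rw [h1, h4, add_zero]
    exact Submodule.smul_mem _ _ (Submodule.mem_span_singleton_self _)
  · rw [Submodule.span_singleton_le_iff_mem]
    exact hmem hε

lemma isSpectralEigenvalue_iff_exists (p : Set.Ico (0 : ℝ) 1) (Λ : ℂ) :
    IsSpectralEigenvalue p Λ ↔ ∃ x : hOne × hOne, x ≠ 0 ∧ linearization p x = Λ • x := by
  simp only [IsSpectralEigenvalue, Prod.exists, linearization_eq_smul_iff]
  rfl

lemma isSpectralEigenvalue_iff (p : Set.Ico (0 : ℝ) 1) (Λ : ℂ) :
    IsSpectralEigenvalue p Λ ↔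
      ∃ m : ℕ, Λ = Complex.I * (Omega m : ℂ) ∨ Λ = -(Complex.I * (Omega m : ℂ)) := by
  rw [isSpectralEigenvalue_iff_exists]
  constructor
  · rintro ⟨x, hx0, hx⟩
    by_contra! hΛ
    refine hx0 ((JetVanish.zero p x).eq_zero (maxGenEigenspace_le_sqGenEigenspace p Λ
      ((linearization p).genEigenspace Λ |>.monotone le_top
        (Module.End.mem_eigenspace_iff.mpr hx))) fun s _ h => ?_)
    have h1 : Λ ^ 2 = (Complex.I * (Omega s : ℂ)) ^ 2 := by
      rw [h, mul_pow, Complex.I_sq]; ring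
    rcases sq_eq_sq_iff_eq_or_eq_neg.mp h1 with h2 | h2
    exacts [(hΛ s).1 h2, (hΛ s).2 h2]
  · rintro ⟨m, hm⟩
    -- The pair `(e_0, ε e_0)` is not an eigenvector, so `m = 0` takes `(e_0, 0)` instead.
    rcases Nat.eq_zero_or_pos m with rfl | hpos
    · refine ⟨kerVec p 0, (linearIndependent_kerVec p).ne_zero 0, ?_⟩
      have : Λ = 0 := by simpa [Omega_zero] using hm
      rw [(linearization_kerVec p).1, this, zero_smul]
    · rcases hm with rfl | rfl
      · exact ⟨_, linEigenVec_ne_zero p m _, linearization_linEigenVec hpos Complex.I_sq⟩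
      · rw [← neg_mul]
        exact ⟨_, linEigenVec_ne_zero p m _,
          linearization_linEigenVec hpos (by rw [neg_sq, Complex.I_sq])⟩

lemma finrank_maxGenEigenspace {p : Set.Ico (0 : ℝ) 1} {m : ℕ} (hm : 2 ≤ m) {ε : ℂ}
    (hε : ε ^ 2 = -1) :
    Module.finrank ℂ ((linearization p).maxGenEigenspace (ε * Omega m)) = 1 := by
  rw [maxGenEigenspace_eq_span hm hε]
  exact finrank_span_singleton (linEigenVec_ne_zero p m ε)

end ConformalFlow

end

theorem mainTheorem6 (p : Set.Ico (0 : ℝ) 1) :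
    -- the eigenvalues are exactly the numbers `± i Ω_m`
    (∀ Λ : ℂ, ConformalFlow.IsSpectralEigenvalue p Λ ↔
      ∃ m : ℕ, Λ = Complex.I * (ConformalFlow.Omega m : ℂ) ∨ Λ = -(Complex.I * (ConformalFlow.Omega m : ℂ))) ∧
    -- the eigenvalue zero has algebraic multiplicity four and geometric multiplicity three
    Module.finrank ℂ ((ConformalFlow.linearization p).maxGenEigenspace 0) = 4 ∧
    Module.finrank ℂ ((ConformalFlow.linearization p).eigenspace 0) = 3 ∧
    -- its Jordan form has one block of size two and two blocks of size one
    (∃ v : Module.Basis (Fin 4) ℂ ((ConformalFlow.linearization p).maxGenEigenspace 0),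
      ConformalFlow.linearization p (v 0) = 0 ∧ ConformalFlow.linearization p (v 1) = v 0 ∧
      ConformalFlow.linearization p (v 2) = 0 ∧ ConformalFlow.linearization p (v 3) = 0) ∧
    -- the nonzero eigenvalues are algebraically simple
    (∀ m : ℕ, 2 ≤ m → ∀ Λ : ℂ,
      (Λ = Complex.I * (ConformalFlow.Omega m : ℂ) ∨ Λ = -(Complex.I * (ConformalFlow.Omega m : ℂ))) →
      Module.finrank ℂ ((ConformalFlow.linearization p).maxGenEigenspace Λ) = 1) := by
  refine ⟨ConformalFlow.isSpectralEigenvalue_iff p, ?_, ConformalFlow.finrank_eigenspace_zero p,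
    ⟨ConformalFlow.kerBasis p, ?_⟩, ?_⟩
  · rw [Module.finrank_eq_card_basis (ConformalFlow.kerBasis p), Fintype.card_fin]
  · simp only [ConformalFlow.kerBasis_apply]
    exact ConformalFlow.linearization_kerVec p
  · rintro m hm Λ (rfl | rfl)
    · exact ConformalFlow.finrank_maxGenEigenspace hm Complex.I_sq
    · rw [← neg_mul]
      exact ConformalFlow.finrank_maxGenEigenspace hm (by rw [neg_sq, Complex.I_sq])
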